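/- **Setting (qCCS).** Let $Chan$ be a set of channel names and $Var$ a countably infinite set of quantum variables. Each $x\in Var$ has a state space $\mathcal H_x=\mathbb C^{d_x}$, $d_x\ge 1$; variables with equal state spaces have the same type, and for every $x$ there are infinitely many variables of the type of $x$. Put $\mathcal H_X=\bigotimes_{x\in X}\mathcal H_x$; the environment $\mathcal H=\mathcal H_{Var}$ is the infinite tensor product with respect to the reference vectors $|0\rangle_x$. $\mathcal D(\mathcal H)$ is the set of positive operators of trace $\le 1$. A super-operator is a completely positive, trace-non-increasing linear map on operators. Write $D(\rho,\sigma)=\frac12\mathrm{tr}|\rho-\sigma|$ and $D_\diamond(\mathcal E,\mathcal F)=\sup D((\mathcal E\otimes\mathcal I_{\mathcal H'})(\rho),(\mathcal F\otimes\mathcal I_{\mathcal H'})(\rho))$ over finite-dimensional $\mathcal H'$ and partial density operators $\rho$ on the tensor product with $\mathcal H'$. Processes ($\mathcal P$) are given by $$P::=A(\widetilde x)\mid \mathbf{nil}\mid \tau.P\mid \mathcal E[X].P\mid c?x.P\mid c!x.P\mid P+P\mid P\|P\mid P\backslash L,$$ where $\widetilde x$ are distinct variables, $X\subseteq Var$ is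 finite, $\mathcal E$ is a super-operator on $\mathcal H_X$, $L\subseteq Chan$, $x\notin fv(P)$ in $c!x.P$, and $fv(P)\cap fv(Q)=\emptyset$ in $P\|Q$. Here $fv(A(\widetilde x))=\{\widetilde x\}$, $fv(\mathcal E[X].P)=fv(P)\cup X$, $c?x$ binds $x$, $fv(c!x.P)=fv(P)\cup\{x\}$, and $fv$ is otherwise the union over the components. Each constant scheme $A$ has a defining equation $A(\widetilde x)\stackrel{def}{=}P$ with $P\in\mathcal P$, $fv(P)\subseteq\{\widetilde x\}$. A substitution is a one-to-one type-preserving $f:Var\to Var$ that moves finitely many variables; $Pf$ replaces free $x$ by $f(x)$ (and $\mathcal E[X]$ by $(f\mathcal Ef^{-1})[f(X)]$), up to bound variables; $\{y/x\}$ exchanges $x$ and $y$ (of the same type). Transitions between configurations $\langle P,\rho\rangle$, $\rho\in\mathcal D(\mathcal H)$, are generated by: $\langle\tau.P,\rho\rangle\xrightarrow{\tau}\langle P,\rho\rangle$; $\langle\mathcal E[X].P,\rho\rangle\xrightarrow{\mathcal E[X]}\langle P,(\mathcal E\otimes\mathcal I_{Var-X})(\rho)\rangle$; $\langle c?x.P,\rho\rangle\xrightarrow{c?y}\langle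 P\{y/x\},\rho\rangle$ for $y\notin fv(c?x.P)$; $\langle c!x.P,\rho\rangle\xrightarrow{c!x}\langle P,\rho\rangle$; $P+Q$ has the transitions of $P$ and of $Q$; $P\|Q$ has those of each component with the other unchanged (for an input $c?x$ only if $x$ is not free in the other), and a $\tau$ from matching $c?x$ and $c!x$; $P\backslash L$ has those of $P$ whose channel, if any, is not in $L$; $A(\widetilde y)$ has those of $P\{\widetilde y/\widetilde x\}$ if $A(\widetilde x)\stackrel{def}{=}P$. A *strong bisimulation* is a symmetric relation $\mathcal R$ on configurations such that $\langle P,\rho\rangle\mathcal R\langle Q,\sigma\rangle$ implies: (i) each non-input $\langle P,\rho\rangle\xrightarrow{\alpha}\langle P',\rho'\rangle$ is matched by some $\langle Q,\sigma\rangle\xrightarrow{\alpha}\langle Q',\sigma'\rangle$ with $\langle P',\rho'\rangle\mathcal R\langle Q',\sigma'\rangle$; (ii) each $\langle P,\rho\rangle\xrightarrow{c?x}\langle P',\rho\rangle$ with $x\notin fv(P)\cup fv(Q)$ is matched by some $\langle Q,\sigma\rangle\xrightarrow{c?x}\langle Q',\sigma\rangle$ such that $\langle P'\{y/x\},\rho\rangle\mathcal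 R\langle Q'\{y/x\},\sigma\rangle$ for all $y\notin(fv(P')\cup fv(Q'))-\{x\}$ of the type of $x$. For real $\lambda\ge0$, a *strong $\lambda$-bisimulation* is a symmetric $\mathcal R$ that contains all $(\langle P,\rho\rangle,\langle P,\sigma\rangle)$ with $D(\rho,\sigma)\le\lambda$ and satisfies (i) for $\alpha$ equal to $\tau$ or an output, (ii), and: each $\langle P,\rho\rangle\xrightarrow{\mathcal E[X]}\langle P',\rho'\rangle$ is matched by some $\langle Q,\sigma\rangle\xrightarrow{\mathcal F[X]}\langle Q',\sigma'\rangle$ with $\langle P',\rho'\rangle\mathcal R\langle Q',\sigma'\rangle$ and $D_\diamond(\mathcal E,\mathcal F)\le\lambda$. Write $P\sim Q$ (resp. $P\sim_\lambda Q$) if for every $\rho$ some strong bisimulation (resp. $\lambda$-bisimulation) relates $\langle P,\rho\rangle$ and $\langle Q,\rho\rangle$. *Operation reduction* $P\to P'$ is the least reflexive, transitive relation closed under all constructors other than constants that replaces, within a string of prefixes, a substring $\mathcal E^{(1)}[X_1]\cdots\mathcal E^{(n)}[X_n]$ ($n\ge1$) by $\mathcal E[X]$, with $X=\bigcup_iX_i$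 and $\mathcal E=(\mathcal E^{(n)}\otimes\mathcal I_{X-X_n})\circ\cdots\circ(\mathcal E^{(1)}\otimes\mathcal I_{X-X_1})$. Let $P\simeq Q$ if $P\sim P_1\to P_2$, $Q\sim Q_1\to Q_2$ and $P_2\sim Q_2$ for some $P_1,P_2,Q_1,Q_2\in\mathcal P$; *strong reduction-bisimilarity* $\stackrel{*}{\sim}$ is the transitive closure of $\simeq$. Let $P\stackrel{*}{\sim}_\lambda Q$ if there are $n\ge0$, $\lambda_i\ge0$ with $\sum_{i=1}^n\lambda_i\le\lambda$, and processes with $P\stackrel{*}{\sim}R_1\sim_{\lambda_1}R_1'\stackrel{*}{\sim}\cdots\stackrel{*}{\sim}R_n\sim_{\lambda_n}R_n'\stackrel{*}{\sim}Q$ (for $n=0$: $P\stackrel{*}{\sim}Q$). The strong reduction-bisimulation distance is $$D_{srb}(P,Q)=\inf\{\lambda\ge0: P\stackrel{*}{\sim}_\lambda Q\}\in[0,\infty],\qquad \inf\emptyset=\infty.$$ **Theorem.** 1. $D_{srb}$ is a pseudo-metric on $\mathcal P$ with values in $[0,\infty]$: $D_{srb}(P,P)=0$, $D_{srb}(P,Q)=D_{srb}(Q,P)$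 and $D_{srb}(P,R)\le D_{srb}(P,Q)+D_{srb}(Q,R)$. 2. For all $P,Q\in\mathcal P$ (and $R\in\mathcal P$, $L\subseteq Chan$), whenever the terms shown are processes: (a) $D_{srb}(\alpha.P,\alpha.Q)\le D_{srb}(P,Q)$ if $\alpha$ is $\tau$, an output $c!x$ or an input $c?x$; (b) $D_{srb}(\mathcal E[X].P,\mathcal F[Y].Q)\le\max\{\eta_{X,Y},\,D_\diamond(\mathcal E,\mathcal F)+D_{srb}(P,Q)\}$, where $\eta_{X,Y}=0$ if $X=Y$ and $\eta_{X,Y}=\infty$ otherwise (so that the bound is $\infty$ if $X\ne Y$); (c) $D_{srb}(P+R,Q+R)\le D_{srb}(P,Q)$; (d) $D_{srb}(P\|R,Q\|R)\le D_{srb}(P,Q)$ if all super-operators occurring in $P$, $Q$ and $R$ are trace-preserving; (e) $D_{srb}(P\backslash L,Q\backslash L)\le D_{srb}(P,Q)$. -/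

import Mathlib

open scoped NNReal ENNReal ComplexOrder

universe u v

namespace QCCS

/-- Partial density operators on the finite-dimensional space `ℂ^ι`. -/
def IsPDens {ι : Type*} [Fintype ι] (ρ : Matrix ι ι ℂ) : Prop :=
  ρ.PosSemidef ∧ ρ.trace.re ≤ 1

/-- `E ⊗ I` on `ℂ^ι ⊗ ℂ^κ`, computed blockwise. -/
def tensorId {ι κ : Type*} (E : Matrix ι ι ℂ →ₗ[ℂ] Matrix ι ι ℂ) (A : Matrix (ι × κ) (ι × κ) ℂ) :
    Matrix (ι × κ) (ι × κ) ℂ :=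
  Matrix.of fun p q => E (Matrix.of fun i j => A (i, p.2) (j, q.2)) p.1 q.1

/-- Super-operators on `ℂ^ι`: linear, trace-non-increasing and completely positive. -/
structure SuperOp (ι : Type*) [Fintype ι] where
  toLin : Matrix ι ι ℂ →ₗ[ℂ] Matrix ι ι ℂ
  trace_le : ∀ ρ, IsPDens ρ → (toLin ρ).trace.re ≤ ρ.trace.re
  cp : ∀ (n : ℕ) (A : Matrix (ι × Fin n) (ι × Fin n) ℂ), A.PosSemidef →
    (tensorId toLin A).PosSemidef

/-- A factorisation of the index set `I` as `K` times a rest: `res` reads the `K`-component and `upd`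
overwrites it. It presents the space with basis `I` as a tensor product of `ℂ^K` and a remainder. -/
structure Lens (I K : Type*) where
  res : I → K
  upd : I → K → I
  res_upd : ∀ i k, res (upd i k) = k
  upd_res : ∀ i, upd i (res i) = i
  upd_upd : ∀ i k l, upd (upd i k) l = upd i l

/-- Exchange the `K`-component of the first entry with the second entry. -/
def Lens.swapEquiv {I K : Type*} (L : Lens I K) : I × K ≃ I × K where
  toFun p := (L.upd p.1 p.2, L.res p.1)
  invFun p := (L.upd p.1 p.2, L.res p.1)
  left_inv p := by simp [L.res_upd, L.upd_upd, L.upd_res]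
  right_inv p := by simp [L.res_upd, L.upd_upd, L.upd_res]

namespace SuperOp
variable {ι κ : Type*} [Fintype ι] [Fintype κ]

theorem cp' (E : SuperOp ι) {μ : Type*} [Finite μ] (A : Matrix (ι × μ) (ι × μ) ℂ)
    (hA : A.PosSemidef) : (tensorId E.toLin A).PosSemidef := by
  obtain ⟨n, ⟨e⟩⟩ := Finite.exists_equiv_fin μ
  have h := E.cp n (A.submatrix (Prod.map id e.symm) (Prod.map id e.symm)) (hA.submatrix _)
  have h2 := h.submatrix (Prod.map id e)
  convert h2 using 1
  ext p q
  simp [tensorId]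

theorem posSemidef (E : SuperOp ι) {A : Matrix ι ι ℂ} (hA : A.PosSemidef) :
    (E.toLin A).PosSemidef := by
  have h := (E.cp 1 (A.submatrix Prod.fst Prod.fst) (hA.submatrix _)).submatrix
    (fun i : ι => (i, (0 : Fin 1)))
  exact h

/-- Trace-preserving super-operators. -/
def IsTracePreserving (E : SuperOp ι) : Prop :=
  ∀ ρ, IsPDens ρ → (E.toLin ρ).trace = ρ.trace

/-- The identity super-operator. -/
def id (ι : Type*) [Fintype ι] : SuperOp ι where
  toLin := LinearMap.id
  trace_le _ _ := le_rfl
  cp _ _ hA := hA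

/-- Composition, `E` first. -/
def comp (F E : SuperOp ι) : SuperOp ι where
  toLin := F.toLin ∘ₗ E.toLin
  trace_le ρ hρ := (F.trace_le _ ⟨E.posSemidef hρ.1, (E.trace_le ρ hρ).trans hρ.2⟩).trans
    (E.trace_le ρ hρ)
  cp n A hA := F.cp n _ (E.cp n A hA)

/-- Transport along the unitary `ℂ^ι ≅ ℂ^κ` that maps basis vectors by `e`. -/
def reindex (e : ι ≃ κ) (E : SuperOp ι) : SuperOp κ where
  toLin := (Matrix.reindexLinearEquiv ℂ ℂ e e).toLinearMap ∘ₗ E.toLin ∘ₗ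
    (Matrix.reindexLinearEquiv ℂ ℂ e e).symm.toLinearMap
  trace_le ρ hρ := by
    have ht : ∀ A : Matrix ι ι ℂ, (A.submatrix e.symm e.symm).trace = A.trace := fun A => by
      simp only [Matrix.trace, Matrix.diag, Matrix.submatrix_apply]
      exact Equiv.sum_comp e.symm (fun i => A i i)
    have ht' : (ρ.submatrix e e).trace = ρ.trace := by
      simp only [Matrix.trace, Matrix.diag, Matrix.submatrix_apply]
      exact Equiv.sum_comp e (fun i => ρ i i)
    have := E.trace_le (ρ.submatrix e e) ⟨hρ.1.submatrix _, by rw [ht']; exact hρ.2⟩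
    rw [ht'] at this
    simpa [Matrix.reindex_apply, ht] using this
  cp n A hA := by
    have h := (E.cp n (A.submatrix (Prod.map e _root_.id) (Prod.map e _root_.id))
      (hA.submatrix _)).submatrix (Prod.map e.symm _root_.id)
    exact h

theorem extend_trace_le (L : Lens ι κ) (E : SuperOp κ) {ρ : Matrix ι ι ℂ} (hρ : IsPDens ρ) :
   (∑ i, E.toLin (Matrix.of fun k l => ρ (L.upd i k) (L.upd i l)) (L.res i) (L.res i)).re ≤ ρ.trace.re := by
  classical
  rcases isEmpty_or_nonempty κ with hκ | hκ
  · have : IsEmpty ι := ⟨fun i => hκ.elim (L.res i)⟩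
    simp [Matrix.trace]
  have hdiag : ∀ i, 0 ≤ (ρ i i).re := fun i => (Complex.nonneg_iff.1 (hρ.1.diag_nonneg (i := i))).1
  set b : ι → Matrix κ κ ℂ := fun i => ρ.submatrix (L.upd i) (L.upd i) with hb
  have hupd : ∀ i k, b (L.upd i k) = b i := fun i k => by
    ext k l; simp [hb, L.upd_upd]
  have hinj : ∀ i, Function.Injective (L.upd i) := fun i k l h => by
    rw [← L.res_upd i k, h, L.res_upd]
  have hble : ∀ i, (E.toLin (b i)).trace.re ≤ (b i).trace.re := fun i => by
    refine E.trace_le _ ⟨hρ.1.submatrix _, le_trans ?_ hρ.2⟩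
    simp only [Matrix.trace, Matrix.diag, Complex.re_sum, hb, Matrix.submatrix_apply]
    rw [← Finset.sum_image (f := fun i => (ρ i i).re) (fun a _ c _ h => hinj i h)]
    exact Finset.sum_le_univ_sum_of_nonneg hdiag
  have key : ∀ g : ι → κ → ℝ, (∀ i k l, g (L.upd i k) l = g i l) →
      (Fintype.card κ : ℝ) * ∑ i, g i (L.res i) = ∑ i, ∑ k, g i k := by
    intro g hg
    have : ∑ p : ι × κ, g p.1 (L.res p.1) = ∑ p : ι × κ, g p.1 p.2 := by
      rw [← Equiv.sum_comp L.swapEquiv]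
      refine Finset.sum_congr rfl fun p _ => ?_
      simp [Lens.swapEquiv, L.res_upd, hg]
    rw [Fintype.sum_prod_type, Fintype.sum_prod_type] at this
    rw [← this]; simp [Finset.mul_sum]
  have hc : (0 : ℝ) < Fintype.card κ := by exact_mod_cast Fintype.card_pos
  rw [Complex.re_sum]
  refine le_of_mul_le_mul_left ?_ hc
  have e1 := key (fun i k => (E.toLin (b i) k k).re) (fun i k l => by simp only [hupd])
  have e2 := key (fun i k => (b i k k).re) (fun i k l => by simp only [hupd])
  have e3 : ρ.trace.re = ∑ i, (b i (L.res i) (L.res i)).re := by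
    simp [Matrix.trace, Matrix.diag, hb, L.upd_res]
  rw [e3, e2]
  refine le_trans (le_of_eq e1) (Finset.sum_le_sum fun i _ => ?_)
  have := hble i
  simpa [Matrix.trace, Matrix.diag] using this
/-- `E ⊗ I` on `ℂ^ι`, where `ℂ^ι` is the tensor product of `ℂ^κ` and a remainder. -/
def extend (L : Lens ι κ) (E : SuperOp κ) : SuperOp ι where
  toLin :=
    { toFun := fun A => Matrix.of fun i j =>
        E.toLin (Matrix.of fun k l => A (L.upd i k) (L.upd j l)) (L.res i) (L.res j)
      map_add' := fun A B => by
        ext i j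
        exact congrFun (congrFun (E.toLin.map_add (Matrix.of fun k l => A (L.upd i k) (L.upd j l))
          (Matrix.of fun k l => B (L.upd i k) (L.upd j l))) (L.res i)) (L.res j)
      map_smul' := fun c A => by
        ext i j
        exact congrFun (congrFun (E.toLin.map_smul c (Matrix.of fun k l => A (L.upd i k) (L.upd j l)))
          (L.res i)) (L.res j) }
  trace_le ρ hρ := extend_trace_le L E hρ
  cp n A hA := by
    have h1 : (A.submatrix (fun p : κ × (ι × Fin n) => (L.upd p.2.1 p.1, p.2.2))
      (fun p : κ × (ι × Fin n) => (L.upd p.2.1 p.1, p.2.2))).PosSemidef := hA.submatrix _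
    exact (E.cp' _ h1).submatrix (fun p : ι × Fin n => (L.res p.1, p))

end SuperOp

/-- The Hilbert space `ℓ²(I)`, with the orthonormal basis `|i⟩`, `i ∈ I`. -/
noncomputable abbrev L2 (I : Type*) := lp (fun _ : I => ℂ) 2

/-- `|i⟩` -/
noncomputable def ket {I : Type*} (i : I) : L2 I := by
  classical exact lp.single 2 i 1

/-- The trace of a positive operator, `∑ᵢ ⟨i|A|i⟩`, possibly `∞`. -/
noncomputable def opTrace {I : Type*} (A : L2 I →L[ℂ] L2 I) : ℝ≥0∞ :=
  ∑' i, ENNReal.ofReal (inner ℂ (ket i) (A (ket i))).re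

/-- Partial density operators on `ℓ²(I)`: positive, of trace at most `1`. -/
def DensOp (I : Type*) := {ρ : L2 I →L[ℂ] L2 I // ρ.IsPositive ∧ opTrace ρ ≤ 1}

/-- `tr |A|`, with `|A| = √(A†A)`, through the spectral decomposition of `A†A`. -/
noncomputable def traceNorm {ι : Type*} [Fintype ι] [DecidableEq ι] (A : Matrix ι ι ℂ) : ℝ :=
  ∑ i, √((Matrix.isHermitian_conjTranspose_mul_self A).eigenvalues i)

/-- The diamond trace distance; the supremum is over all `ℂⁿ` as auxiliary spaces and all partial
density operators on `ℂ^ι ⊗ ℂⁿ`. -/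
noncomputable def diamondDist {ι : Type*} [Fintype ι] [DecidableEq ι] (E F : SuperOp ι) : ℝ≥0∞ :=
  ⨆ (n : ℕ) (ρ : Matrix (ι × Fin n) (ι × Fin n) ℂ) (_ : IsPDens ρ),
    ENNReal.ofReal (traceNorm (tensorId E.toLin ρ - tensorId F.toLin ρ) / 2)

/-- `|A| = √(A†A)` -/
noncomputable def opAbs {H : Type*} [NormedAddCommGroup H] [InnerProductSpace ℂ H] [CompleteSpace H]
  (A : H →L[ℂ] H) : H →L[ℂ] H := CFC.abs A

/-- The trace distance `½ tr |ρ - σ|`. -/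
noncomputable def traceDist {I : Type*} (ρ σ : DensOp I) : ℝ≥0∞ :=
  2⁻¹ * opTrace (opAbs (ρ.1 - σ.1))

section cyl
variable {I K : Type*}

open Classical in
/-- The permutation of `I` that exchanges the components `m` and `k`. -/
noncomputable def Lens.swapFib (L : Lens I K) (m k : K) : Equiv.Perm I :=
  Function.Involutive.toPerm
    (fun i => if L.res i = m then L.upd i k else if L.res i = k then L.upd i m else i) (by
      intro i
      by_cases h1 : L.res i = m
      · subst h1
        by_cases h2 : k = L.res i
        · subst h2; simp [L.upd_res]
        · simp [h2, L.res_upd, L.upd_upd, L.upd_res]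
      · by_cases h2 : L.res i = k
        · subst h2; simp [h1, L.res_upd, L.upd_upd, L.upd_res]
        · simp [h1, h2])

open Classical in
theorem Lens.swapFib_apply (L : Lens I K) (m k : K) (i : I) : L.swapFib m k i =
    if L.res i = m then L.upd i k else if L.res i = k then L.upd i m else i := rfl

theorem Lens.swapFib_of_eq (L : Lens I K) {m k : K} {i : I} (h : L.res i = m) :
    L.swapFib m k i = L.upd i k := by
  simp [Lens.swapFib_apply, h]

open Classical in
/-- `|m⟩⟨k| ⊗ I`, on vectors. -/
noncomputable def matUnitLin (L : Lens I K) (m k : K) : L2 I →ₗ[ℂ] L2 I where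
  toFun φ := ⟨fun i => if L.res i = m then φ (L.upd i k) else 0, by
    refine memℓp_gen ?_
    have h := (lp.memℓp φ).summable (by norm_num)
    refine Summable.of_nonneg_of_le (fun i => by positivity) (fun i => ?_)
      ((L.swapFib m k).summable_iff.2 h)
    by_cases hi : L.res i = m
    · simp [hi, L.swapFib_of_eq hi]
    · simp [hi]⟩
  map_add' φ ψ := by
    ext i
    change (if L.res i = m then φ (L.upd i k) + ψ (L.upd i k) else 0) =
      (if L.res i = m then φ (L.upd i k) else 0) + (if L.res i = m then ψ (L.upd i k) else 0)
    by_cases hi : L.res i = m <;> simp [hi]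
  map_smul' c φ := by
    ext i
    by_cases hi : L.res i = m <;> simp [hi]

theorem norm_matUnitLin_le (L : Lens I K) (m k : K) (φ : L2 I) :
    ‖matUnitLin L m k φ‖ ≤ 1 * ‖φ‖ := by
  classical
  rw [one_mul]
  refine lp.norm_le_of_tsum_le (by norm_num) (norm_nonneg _) ?_
  have h' := (L.swapFib m k).summable_iff.2 ((lp.memℓp φ).summable (by norm_num))
  have hle : ∀ i, ‖matUnitLin L m k φ i‖ ^ (ENNReal.toReal 2) ≤
      ‖φ (L.swapFib m k i)‖ ^ (ENNReal.toReal 2) := fun i => by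
    change ‖(if L.res i = m then φ (L.upd i k) else 0 : ℂ)‖ ^ _ ≤ _
    by_cases hi : L.res i = m
    · simp [hi, L.swapFib_of_eq hi]
    · simp [hi]
  rw [lp.norm_rpow_eq_tsum (by norm_num) φ,
    ← (L.swapFib m k).tsum_eq (fun i => ‖φ i‖ ^ (ENNReal.toReal 2))]
  exact Summable.tsum_le_tsum hle (Summable.of_nonneg_of_le (fun i => by positivity) hle h') h'

/-- `|m⟩⟨k| ⊗ I` on `ℂ^K ⊗ H'`, as a bounded operator. -/
noncomputable def matUnit (L : Lens I K) (m k : K) : L2 I →L[ℂ] L2 I :=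
  (matUnitLin L m k).mkContinuous 1 (norm_matUnitLin_le L m k)

open Classical in
theorem matUnit_apply (L : Lens I K) (m k : K) (φ : L2 I) (i : I) :
    matUnit L m k φ i = if L.res i = m then φ (L.upd i k) else 0 := rfl

theorem inner_matUnit (L : Lens I K) (m k : K) (φ ψ : L2 I) :
    inner ℂ φ (matUnit L m k ψ) = inner ℂ (matUnit L k m φ) ψ := by
  classical
  rw [lp.inner_eq_tsum, lp.inner_eq_tsum, ← (L.swapFib m k).tsum_eq (fun i => inner ℂ (matUnit L k m φ i) (ψ i))]
  refine tsum_congr fun i => ?_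
  rw [matUnit_apply, matUnit_apply]
  by_cases h1 : L.res i = m
  · rw [L.swapFib_of_eq h1]
    have h3 : L.upd i m = i := by rw [← h1, L.upd_res]
    simp [h1, L.res_upd, L.upd_upd, h3]
  · by_cases h2 : L.res i = k
    · subst h2
      simp [Lens.swapFib_apply, h1, L.res_upd, Ne.symm h1]
    · simp [Lens.swapFib_apply, h1, h2]

open Classical in
theorem ket_apply (i j : I) : (ket i : L2 I) j = if j = i then 1 else 0 := by
  unfold ket
  rw [lp.single_apply, Pi.single_apply]

open Classical in
theorem matUnit_ket (L : Lens I K) (m k : K) (i : I) :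
    matUnit L m k (ket i) = if L.res i = k then ket (L.upd i m) else 0 := by
  ext j
  rw [matUnit_apply, ket_apply]
  split_ifs with h1 h2 h3 h4 h5
  · subst h2; subst h1; rw [L.upd_upd, L.upd_res, ket_apply, if_pos rfl]
  · exact absurd (by rw [← h2, L.res_upd]) h3
  · subst h1 h4
    rw [ket_apply, if_neg]
    · intro h; apply h2; rw [h, L.upd_upd, L.upd_res]
  · rfl
  · subst h5; rw [ket_apply, if_neg]
    intro h; apply h1; rw [h, L.res_upd]
  · rfl

variable [Fintype K] [DecidableEq K]

/-- `(E ⊗ I)(ρ) = ∑ ⟨m|E(|k⟩⟨l|)|n⟩ (|m⟩⟨k| ⊗ I) ρ (|l⟩⟨n| ⊗ I)`. -/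
noncomputable def cylOp (L : Lens I K) (E : SuperOp K) (ρ : L2 I →L[ℂ] L2 I) : L2 I →L[ℂ] L2 I :=
  ∑ k, ∑ l, ∑ m, ∑ n, E.toLin (Matrix.single k l 1) m n •
    (matUnit L m k ∘L ρ ∘L matUnit L l n)

theorem toLin_eq_sum (E : SuperOp K) (A : Matrix K K ℂ) (m n : K) :
    E.toLin A m n = ∑ k, ∑ l, A k l * E.toLin (Matrix.single k l 1) m n := by
  conv_lhs => rw [Matrix.matrix_eq_sum_single A]
  simp only [map_sum, Matrix.sum_apply]
  refine Finset.sum_congr rfl fun k _ => Finset.sum_congr rfl fun l _ => ?_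
  rw [← mul_one (A k l), ← smul_eq_mul, ← Matrix.smul_single, map_smul]
  simp

theorem inner_cylOp (L : Lens I K) (E : SuperOp K) (ρ : L2 I →L[ℂ] L2 I) (φ ψ : L2 I) :
    inner ℂ φ (cylOp L E ρ ψ) = ∑ m, ∑ n,
      E.toLin (Matrix.of fun k l => inner ℂ (matUnit L k m φ) (ρ (matUnit L l n ψ))) m n := by
  simp only [cylOp, _root_.sum_apply, inner_sum, _root_.smul_apply,
    ContinuousLinearMap.comp_apply, inner_smul_right, inner_matUnit L _ _ φ]
  conv_rhs => enter [2, m, 2, n]; rw [toLin_eq_sum]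
  rw [Finset.sum_congr rfl fun k _ => Finset.sum_comm]
  rw [Finset.sum_comm]
  refine Finset.sum_congr rfl fun m _ => ?_
  rw [Finset.sum_congr rfl fun k _ => Finset.sum_comm]
  rw [Finset.sum_comm]
  refine Finset.sum_congr rfl fun n _ => Finset.sum_congr rfl fun k _ =>
    Finset.sum_congr rfl fun l _ => mul_comm _ _

theorem inner_cylOp_ket (L : Lens I K) (E : SuperOp K) (ρ : L2 I →L[ℂ] L2 I) (i j : I) :
    inner ℂ (ket i) (cylOp L E ρ (ket j)) =
      E.toLin (Matrix.of fun k l => inner ℂ (ket (L.upd i k)) (ρ (ket (L.upd j l)))) (L.res i) (L.res j) := by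
  rw [inner_cylOp]
  simp only [matUnit_ket]
  rw [Finset.sum_eq_single (L.res i), Finset.sum_eq_single (L.res j)]
  · simp
  · intro n _ hn
    simp only [if_neg (Ne.symm hn), map_zero, inner_zero_right]
    exact congrFun (congrFun (map_zero E.toLin) _) _
  · simp
  · intro m _ hm
    refine Finset.sum_eq_zero fun n _ => ?_
    simp only [if_neg (Ne.symm hm), inner_zero_left]
    exact congrFun (congrFun (map_zero E.toLin) _) _
  · simp

theorem gram_posSemidef {J : Type*} [Finite J] {ρ : L2 I →L[ℂ] L2 I} (hρ : ρ.IsPositive) (v : J → L2 I) :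
    Matrix.PosSemidef (Matrix.of fun a b => inner ℂ (v a) (ρ (v b)) : Matrix J J ℂ) := by
  have := Fintype.ofFinite J
  refine Matrix.PosSemidef.of_dotProduct_mulVec_nonneg ?_ fun x => ?_
  · ext a b
    rw [Matrix.conjTranspose_apply]
    simp only [Matrix.of_apply, RCLike.star_def, inner_conj_symm]
    exact hρ.isSymmetric _ _
  · have : star x ⬝ᵥ (Matrix.mulVec (Matrix.of fun a b => inner ℂ (v a) (ρ (v b)) : Matrix J J ℂ) x) =
        inner ℂ (∑ a, x a • v a) (ρ (∑ a, x a • v a)) := by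
      simp only [map_sum, map_smul, sum_inner, inner_sum, inner_smul_left, inner_smul_right,
        dotProduct, Matrix.mulVec, Finset.mul_sum, Pi.star_apply, RCLike.star_def, Matrix.of_apply]
      rw [Finset.sum_comm]
      refine Finset.sum_congr rfl fun a _ => Finset.sum_congr rfl fun b _ => by ring
    rw [this]
    exact hρ.inner_nonneg_right _

theorem cylOp_isPositive (L : Lens I K) (E : SuperOp K) {ρ : L2 I →L[ℂ] L2 I}
    (hρ : ρ.IsPositive) : (cylOp L E ρ).IsPositive := by
  rw [ContinuousLinearMap.isPositive_iff_complex]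
  intro φ
  have h0 : 0 ≤ inner ℂ φ (cylOp L E ρ φ) := by
    have h := E.cp' _ (gram_posSemidef hρ (fun p : K × K => matUnit L p.1 p.2 φ))
    have h2 := (h.submatrix (fun m : K => (m, m))).dotProduct_mulVec_nonneg (fun _ => 1)
    convert h2 using 1
    rw [inner_cylOp]
    simp [dotProduct, Matrix.mulVec, tensorId]
  have h1 : inner ℂ (cylOp L E ρ φ) φ = inner ℂ φ (cylOp L E ρ φ) := by
    rw [← inner_conj_symm, Complex.conj_eq_iff_im.2 (Complex.nonneg_iff.1 h0).2.symm]
  rw [h1]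
  obtain ⟨ha, hb⟩ := Complex.nonneg_iff.1 h0
  exact ⟨Complex.ext (by simp) (by simpa using hb), ha⟩

theorem opTrace_cylOp_le (L : Lens I K) (E : SuperOp K) {ρ : L2 I →L[ℂ] L2 I}
    (hρ : ρ.IsPositive) (ht : opTrace ρ ≤ 1) : opTrace (cylOp L E ρ) ≤ opTrace ρ := by
  rcases isEmpty_or_nonempty K with hK | hK
  · have : IsEmpty I := ⟨fun i => hK.elim (L.res i)⟩
    simp [opTrace]
  set b : I → Matrix K K ℂ := fun i => Matrix.of fun k l => inner ℂ (ket (L.upd i k)) (ρ (ket (L.upd i l))) with hb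
  have hpos : ∀ i, (b i).PosSemidef := fun i => gram_posSemidef hρ (fun k => ket (L.upd i k))
  have hupd : ∀ i k, b (L.upd i k) = b i := fun i k => by
    ext k l; simp [hb, L.upd_upd]
  have hinj : ∀ i, Function.Injective (L.upd i) := fun i k l h => by
    rw [← L.res_upd i k, h, L.res_upd]
  have htr : ∀ A : Matrix K K ℂ, A.PosSemidef →
      ENNReal.ofReal A.trace.re = ∑ k, ENNReal.ofReal (A k k).re := fun A hA => by
    rw [← ENNReal.ofReal_sum_of_nonneg fun k _ =>
      (Complex.nonneg_iff.1 (hA.diag_nonneg (i := k))).1]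
    simp [Matrix.trace]
  have hb1 : ∀ i, ENNReal.ofReal (b i).trace.re ≤ 1 := fun i => by
    rw [htr _ (hpos i), ← tsum_fintype (L := .unconditional _)]
    exact (ENNReal.tsum_comp_le_tsum_of_injective (hinj i)
      (fun i => ENNReal.ofReal (inner ℂ (ket i) (ρ (ket i))).re)).trans ht
  have hble : ∀ i, ∑ k, ENNReal.ofReal (E.toLin (b i) k k).re ≤
      ∑ k, ENNReal.ofReal (b i k k).re := fun i => by
    rw [← htr _ (hpos i), ← htr _ (E.posSemidef (hpos i))]
    exact ENNReal.ofReal_le_ofReal (E.trace_le _ ⟨hpos i, by simpa using hb1 i⟩)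
  have key : ∀ g : I → K → ℝ≥0∞, (∀ i k l, g (L.upd i k) l = g i l) →
      (Fintype.card K : ℝ≥0∞) * ∑' i, g i (L.res i) = ∑' i, ∑ k, g i k := by
    intro g hg
    have : ∑' p : I × K, g p.1 (L.res p.1) = ∑' p : I × K, g p.1 p.2 := by
      rw [← Equiv.tsum_eq L.swapEquiv]
      refine tsum_congr fun p => ?_
      simp [Lens.swapEquiv, L.res_upd, hg]
    rw [ENNReal.tsum_prod (f := fun i _ => g i (L.res i)),
      ENNReal.tsum_prod (f := fun i k => g i k)] at this
    simp only [tsum_fintype, Finset.sum_const, Finset.card_univ, nsmul_eq_mul,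
      ENNReal.tsum_mul_left] at this
    exact this
  have e1 := key (fun i k => ENNReal.ofReal (E.toLin (b i) k k).re)
    (fun i k l => by simp only [hupd])
  have e2 := key (fun i k => ENNReal.ofReal (b i k k).re) (fun i k l => by simp only [hupd])
  have e3 : opTrace ρ = ∑' i, ENNReal.ofReal (b i (L.res i) (L.res i)).re := by
    simp [opTrace, hb, L.upd_res]
  have e4 : opTrace (cylOp L E ρ) =
      ∑' i, ENNReal.ofReal (E.toLin (b i) (L.res i) (L.res i)).re := by
    simp only [opTrace, inner_cylOp_ket, hb]
  rw [e3, e4]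
  refine (ENNReal.mul_le_mul_iff_right (a := (Fintype.card K : ℝ≥0∞)) (by simp) (by simp)).1 ?_
  rw [e1, e2]
  exact ENNReal.tsum_le_tsum hble

/-- The cylindric extension `E ⊗ I` of a super-operator on `ℂ^K`, acting on partial density
operators. -/
noncomputable def SuperOp.cyl (L : Lens I K) (E : SuperOp K) (ρ : DensOp I) : DensOp I :=
  ⟨cylOp L E ρ.1, cylOp_isPositive L E ρ.2.1,
    (opTrace_cylOp_le L E ρ.2.1 ρ.2.2).trans ρ.2.2⟩

end cyl

/-! ### The signature and the environment -/

/-- The data over which the calculus is built. The `x`-system has the state space `ℂ^(dim x)`, and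
two variables have the same type when these spaces are the same. There is an unlimited supply of
variables of every type that occurs. -/
structure Sig where
  Chan : Type u
  Scheme : Type v
  arity : Scheme → ℕ
  Var : Type
  countable_var : Countable Var
  infinite_var : Infinite Var
  dim : Var → ℕ
  dim_pos : ∀ x, 0 < dim x
  infinite_type : ∀ x, {y | dim y = dim x}.Infinite

noncomputable instance (S : Sig.{u, v}) : DecidableEq S.Var := Classical.decEq _

/-- The index set of the computational basis of `H_X = ⨂_{x ∈ X} H_x`. -/
abbrev Idx (S : Sig.{u, v}) (X : Finset S.Var) : Type := ∀ x : X, Fin (S.dim x)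

/-- The index set of the computational basis of `H = ⨂_{x ∈ Var} H_x`: families of basis indices
that differ from the reference index `0` at finitely many variables only. So `L2 (EnvIdx S)` is the
infinite tensor product taken with respect to the reference vectors `|0⟩_x`. -/
def EnvIdx (S : Sig.{u, v}) : Type :=
  {i : ∀ x : S.Var, Fin (S.dim x) // {x | (i x : ℕ) ≠ 0}.Finite}

/-- `H_X ≅ H_Y ⊗ H_{X - Y}` for `Y ⊆ X`. -/
noncomputable def subLens (S : Sig.{u, v}) {X Y : Finset S.Var} (h : Y ⊆ X) : Lens (Idx S X) (Idx S Y) where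
  res i y := i ⟨y, h y.2⟩
  upd i k x := if hx : x.1 ∈ Y then k ⟨x, hx⟩ else i x
  res_upd i k := by ext y; simp
  upd_res i := by ext x; simp
  upd_upd i k l := by
    ext x
    by_cases hx : x.1 ∈ Y <;> simp [hx]

/-- `H ≅ H_X ⊗ H_{Var - X}`. -/
noncomputable def envLens (S : Sig.{u, v}) (X : Finset S.Var) : Lens (EnvIdx S) (Idx S X) where
  res i x := i.1 x
  upd i k := ⟨fun x => if hx : x ∈ X then k ⟨x, hx⟩ else i.1 x, by
    refine (i.2.union X.finite_toSet).subset fun x hx => ?_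
    by_cases h : x ∈ X
    · exact Or.inr h
    · exact Or.inl (by simpa [h] using hx)⟩
  res_upd i k := by ext x; simp
  upd_res i := by
    apply Subtype.ext
    funext x
    simp
  upd_upd i k l := by
    apply Subtype.ext
    funext x
    by_cases hx : x ∈ X <;> simp [hx]

/-- Environment states: partial density operators on `H`. -/
abbrev State (S : Sig.{u, v}) : Type := DensOp (EnvIdx S)

/-! ### Syntax -/

/-- Actions, which are also the prefixes of the syntax. -/
inductive Act (S : Sig.{u, v}) : Type u
  | tau : Act S
  | op (X : Finset S.Var) (E : SuperOp (Idx S X)) : Act S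
  | inp (c : S.Chan) (x : S.Var) : Act S
  | out (c : S.Chan) (x : S.Var) : Act S

namespace Act
variable {S : Sig.{u, v}}

def IsInput : Act S → Prop
  | inp _ _ => True
  | _ => False

/-- `cn(α) ∈ L`; it fails when `cn(α)` is not defined. -/
def ChanMem (L : Set S.Chan) : Act S → Prop
  | tau => False
  | op _ _ => False
  | inp c _ => c ∈ L
  | out c _ => c ∈ L

/-- The free variables of `α.P`, given those of `P`. -/
noncomputable def preFv (F : Finset S.Var) : Act S → Finset S.Var
  | tau => F
  | op X _ => F ∪ X
  | inp _ x => F.erase x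
  | out _ x => insert x F

/-- The side condition for forming `α.P`, given the free variables of `P`. -/
def Ok (F : Finset S.Var) : Act S → Prop
  | out _ x => x ∉ F
  | _ => True

end Act

/-- Terms, before the conditions on free variables are imposed. -/
inductive Raw (S : Sig.{u, v}) : Type (max u v)
  | const (A : S.Scheme) (y : Fin (S.arity A) ↪ S.Var) : Raw S
  | nil : Raw S
  | pre (α : Act S) (P : Raw S) : Raw S
  | sum (P Q : Raw S) : Raw S
  | par (P Q : Raw S) : Raw S
  | restr (P : Raw S) (L : Set S.Chan) : Raw S

/-- A substitution: a one-to-one, type-preserving map on variables that moves finitely many of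
them. Such a map is automatically onto, so it is given as a permutation. -/
structure Subst (S : Sig.{u, v}) where
  perm : Equiv.Perm S.Var
  dim_eq : ∀ x, S.dim (perm x) = S.dim x
  finite : {x | perm x ≠ x}.Finite

/-- The substitution `{y/x}`, which exchanges `x` and `y`. -/
noncomputable def Subst.swap {S : Sig.{u, v}} (x y : S.Var) (h : S.dim y = S.dim x) : Subst S where
  perm := Equiv.swap x y
  dim_eq z := by
    by_cases hx : z = x
    · subst hx; rw [Equiv.swap_apply_left, h]
    · by_cases hy : z = y
      · subst hy; rw [Equiv.swap_apply_right, h]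
      · rw [Equiv.swap_apply_of_ne_of_ne hx hy]
  finite := by
    refine (Set.toFinite {x, y}).subset fun z hz => ?_
    by_contra hn
    simp only [Set.mem_insert_iff, Set.mem_singleton_iff, not_or] at hn
    exact hz (Equiv.swap_apply_of_ne_of_ne hn.1 hn.2)

namespace Subst
variable {S : Sig.{u, v}}

/-- `f(X)`. -/
def image (f : Subst S) (X : Finset S.Var) : Finset S.Var := X.map f.perm.toEmbedding

/-- The isomorphism `H_X ≅ H_{f(X)}` on basis indices: the component at `x` moves to `f x`. -/
def idxEquiv (f : Subst S) (X : Finset S.Var) : Idx S X ≃ Idx S (f.image X) where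
  toFun k y := Fin.cast (by rw [← f.dim_eq, Equiv.apply_symm_apply])
    (k ⟨f.perm.symm y, by
      obtain ⟨x, hx, h⟩ := Finset.mem_map.1 y.2
      rw [← h]
      simpa using hx⟩)
  invFun k x := Fin.cast (f.dim_eq x) (k ⟨f.perm x, Finset.mem_map_of_mem _ x.2⟩)
  left_inv k := by
    funext x
    have h : ∀ z : X, z = x → (k z : ℕ) = k x := fun z hz => by rw [hz]
    exact Fin.ext (h ⟨f.perm.symm (f.perm x), by simp⟩ (Subtype.ext (f.perm.symm_apply_apply x)))
  right_inv k := by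
    funext y
    have h : ∀ z : f.image X, z = y → (k z : ℕ) = k y := fun z hz => by rw [hz]
    exact Fin.ext (h ⟨f.perm (f.perm.symm y), by simp⟩ (Subtype.ext (f.perm.apply_symm_apply y)))

/-- Renaming in a prefix. An operation `E` on `H_X` becomes `f ∘ E ∘ f⁻¹` on `H_{f(X)}`. -/
noncomputable def onAct (f : Subst S) : Act S → Act S
  | .tau => .tau
  | .op X E => .op (f.image X) (E.reindex (f.idxEquiv X))
  | .inp c x => .inp c (f.perm x)
  | .out c x => .out c (f.perm x)

end Subst

namespace Raw
variable {S : Sig.{u, v}}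

noncomputable def fv : Raw S → Finset S.Var
  | const _ y => Finset.univ.map y
  | nil => ∅
  | pre α P => α.preFv P.fv
  | sum P Q => P.fv ∪ Q.fv
  | par P Q => P.fv ∪ Q.fv
  | restr P _ => P.fv

/-- The conditions on free variables in the formation rules. -/
def WF : Raw S → Prop
  | const _ _ => True
  | nil => True
  | pre α P => P.WF ∧ α.Ok P.fv
  | sum P Q => P.WF ∧ Q.WF
  | par P Q => P.WF ∧ Q.WF ∧ Disjoint P.fv Q.fv
  | restr P _ => P.WF

/-- `P f`. A bound variable `x` is renamed to `f x`. Since `f` is one-to-one this captures nothing,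
so the result is, up to the choice of bound variables, the simultaneous substitution of `f x` for
the free occurrences of each `x`. -/
noncomputable def subst (f : Subst S) : Raw S → Raw S
  | const A y => const A (y.trans f.perm.toEmbedding)
  | nil => nil
  | pre α P => pre (f.onAct α) (P.subst f)
  | sum P Q => sum (P.subst f) (Q.subst f)
  | par P Q => par (P.subst f) (Q.subst f)
  | restr P L => restr (P.subst f) L

/-- All super-operators occurring in the term are trace-preserving. -/
def AllTP : Raw S → Prop
  | const _ _ => True
  | nil => True
  | pre (.op _ E) P => E.IsTracePreserving ∧ P.AllTP
  | pre _ P => P.AllTP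
  | sum P Q => P.AllTP ∧ Q.AllTP
  | par P Q => P.AllTP ∧ Q.AllTP
  | restr P _ => P.AllTP

/-- `α₁.….αₘ.P`. -/
def pres (t : List (Act S)) (P : Raw S) : Raw S := t.foldr pre P

theorem fv_subst (f : Subst S) (P : Raw S) : (P.subst f).fv = f.image P.fv := by
  induction P with
  | const A y => simp [subst, fv, Subst.image, Finset.map_map]
  | nil => simp [subst, fv, Subst.image]
  | pre α P ih =>
    cases α <;> simp [subst, fv, Subst.onAct, Act.preFv, ih, Subst.image, Finset.map_union,
      Finset.map_insert, Finset.map_erase]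
  | sum P Q ihP ihQ => simp [subst, fv, ihP, ihQ, Subst.image, Finset.map_union]
  | par P Q ihP ihQ => simp [subst, fv, ihP, ihQ, Subst.image, Finset.map_union]
  | restr P L ih => simpa [subst, fv] using ih

theorem WF.subst (f : Subst S) {P : Raw S} (h : P.WF) : (P.subst f).WF := by
  induction P with
  | const A y => trivial
  | nil => trivial
  | pre α P ih =>
    refine ⟨ih h.1, ?_⟩
    have h2 := h.2
    cases α <;> simp_all [Subst.onAct, Act.Ok, fv_subst, Subst.image]
  | sum P Q ihP ihQ => exact ⟨ihP h.1, ihQ h.2⟩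
  | par P Q ihP ihQ =>
    refine ⟨ihP h.1, ihQ h.2.1, ?_⟩
    rw [fv_subst, fv_subst, Subst.image, Subst.image, Finset.disjoint_map]
    exact h.2.2
  | restr P L ih => exact ih h

end Raw

/-- Quantum processes. -/
def Proc (S : Sig.{u, v}) : Type (max u v) := {P : Raw S // P.WF}

namespace Proc
variable {S : Sig.{u, v}}

noncomputable def fv (P : Proc S) : Finset S.Var := P.1.fv

noncomputable def subst (f : Subst S) (P : Proc S) : Proc S := ⟨P.1.subst f, P.2.subst f⟩

/-- `τ.P` -/
def tau (P : Proc S) : Proc S := ⟨.pre .tau P.1, P.2, trivial⟩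

/-- `E[X].P` -/
def op (X : Finset S.Var) (E : SuperOp (Idx S X)) (P : Proc S) : Proc S :=
  ⟨.pre (.op X E) P.1, P.2, trivial⟩

/-- `c?x.P` -/
def inp (c : S.Chan) (x : S.Var) (P : Proc S) : Proc S := ⟨.pre (.inp c x) P.1, P.2, trivial⟩

/-- `c!x.P` -/
def out (c : S.Chan) (x : S.Var) (P : Proc S) (h : x ∉ P.fv) : Proc S :=
  ⟨.pre (.out c x) P.1, P.2, h⟩

/-- `P + Q` -/
def sum (P Q : Proc S) : Proc S := ⟨.sum P.1 Q.1, P.2, Q.2⟩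

/-- `P ‖ Q` -/
def par (P Q : Proc S) (h : Disjoint P.fv Q.fv) : Proc S := ⟨.par P.1 Q.1, P.2, Q.2, h⟩

/-- `P \ L` -/
def restr (P : Proc S) (L : Set S.Chan) : Proc S := ⟨.restr P.1 L, P.2⟩

end Proc

/-- The defining equations `A(x̃) := P` of the process constant schemes. -/
structure Defn (S : Sig.{u, v}) where
  params : ∀ A : S.Scheme, Fin (S.arity A) ↪ S.Var
  body : S.Scheme → Proc S
  fv_body : ∀ A, (body A).fv ⊆ Finset.univ.map (params A)

/-! ### Operational semantics -/

/-- `Trans Δ P ρ α P' ρ'` is the transition `⟨P, ρ⟩ -α→ ⟨P', ρ'⟩`. -/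
inductive Trans {S : Sig.{u, v}} (Δ : Defn S) :
    Raw S → State S → Act S → Raw S → State S → Prop
  | tau (P : Raw S) (ρ : State S) : Trans Δ (.pre .tau P) ρ .tau P ρ
  | oper (X : Finset S.Var) (E : SuperOp (Idx S X)) (P : Raw S) (ρ : State S) :
      Trans Δ (.pre (.op X E) P) ρ (.op X E) P (E.cyl (envLens S X) ρ)
  | input (c : S.Chan) (x y : S.Var) (h : S.dim y = S.dim x) (P : Raw S) (ρ : State S)
      (hy : y ∉ (Raw.pre (.inp c x) P).fv) :
      Trans Δ (.pre (.inp c x) P) ρ (.inp c y) (P.subst (.swap x y h)) ρ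
  | output (c : S.Chan) (x : S.Var) (P : Raw S) (ρ : State S) :
      Trans Δ (.pre (.out c x) P) ρ (.out c x) P ρ
  | choiceL {P Q P' : Raw S} {α : Act S} {ρ ρ' : State S} (h : Trans Δ P ρ α P' ρ') :
      Trans Δ (.sum P Q) ρ α P' ρ'
  | choiceR {P Q Q' : Raw S} {α : Act S} {ρ ρ' : State S} (h : Trans Δ Q ρ α Q' ρ') :
      Trans Δ (.sum P Q) ρ α Q' ρ'
  | intlInL {P Q P' : Raw S} {c : S.Chan} {x : S.Var} {ρ ρ' : State S}
      (h : Trans Δ P ρ (.inp c x) P' ρ') (hx : x ∉ Q.fv) :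
      Trans Δ (.par P Q) ρ (.inp c x) (.par P' Q) ρ'
  | intlInR {P Q Q' : Raw S} {c : S.Chan} {x : S.Var} {ρ ρ' : State S}
      (h : Trans Δ Q ρ (.inp c x) Q' ρ') (hx : x ∉ P.fv) :
      Trans Δ (.par P Q) ρ (.inp c x) (.par P Q') ρ'
  | intlL {P Q P' : Raw S} {α : Act S} {ρ ρ' : State S}
      (h : Trans Δ P ρ α P' ρ') (hα : ¬ α.IsInput) :
      Trans Δ (.par P Q) ρ α (.par P' Q) ρ'
  | intlR {P Q Q' : Raw S} {α : Act S} {ρ ρ' : State S}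
      (h : Trans Δ Q ρ α Q' ρ') (hα : ¬ α.IsInput) :
      Trans Δ (.par P Q) ρ α (.par P Q') ρ'
  | commL {P Q P' Q' : Raw S} {c : S.Chan} {x : S.Var} {ρ : State S}
      (h₁ : Trans Δ P ρ (.inp c x) P' ρ) (h₂ : Trans Δ Q ρ (.out c x) Q' ρ) :
      Trans Δ (.par P Q) ρ .tau (.par P' Q') ρ
  | commR {P Q P' Q' : Raw S} {c : S.Chan} {x : S.Var} {ρ : State S}
      (h₁ : Trans Δ P ρ (.out c x) P' ρ) (h₂ : Trans Δ Q ρ (.inp c x) Q' ρ) :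
      Trans Δ (.par P Q) ρ .tau (.par P' Q') ρ
  | restr {P P' : Raw S} {L : Set S.Chan} {α : Act S} {ρ ρ' : State S}
      (h : Trans Δ P ρ α P' ρ') (hα : ¬ α.ChanMem L) :
      Trans Δ (.restr P L) ρ α (.restr P' L) ρ'
  | defn {A : S.Scheme} {y : Fin (S.arity A) ↪ S.Var} {f : Subst S} {P' : Raw S} {α : Act S}
      {ρ ρ' : State S} (hf : ∀ i, f.perm (Δ.params A i) = y i)
      (h : Trans Δ ((Δ.body A).1.subst f) ρ α P' ρ') :
      Trans Δ (.const A y) ρ α P' ρ'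

/-- Configurations `⟨P, ρ⟩`. -/
abbrev Conf (S : Sig.{u, v}) := Proc S × State S

section
variable {S : Sig.{u, v}} (Δ : Defn S)

/-- The transition relation on configurations. -/
def Step (C : Conf S) (α : Act S) (C' : Conf S) : Prop := Trans Δ C.1.1 C.2 α C'.1.1 C'.2

/-- The clause for inputs, common to exact and approximate strong bisimulations. -/
def InputClause (R : Conf S → Conf S → Prop) (P : Proc S) (ρ : State S) (Q : Proc S)
    (σ : State S) : Prop :=
  ∀ (c : S.Chan) (x : S.Var) (P' : Proc S), Step Δ (P, ρ) (.inp c x) (P', ρ) →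
    x ∉ P.fv ∪ Q.fv →
    ∃ Q' : Proc S, Step Δ (Q, σ) (.inp c x) (Q', σ) ∧
      ∀ (y : S.Var) (h : S.dim y = S.dim x), y ∉ (P'.fv ∪ Q'.fv) \ {x} →
        R (P'.subst (.swap x y h), ρ) (Q'.subst (.swap x y h), σ)

/-- Strong bisimulations. -/
def IsBisim (R : Conf S → Conf S → Prop) : Prop :=
  (∀ C C', R C C' → R C' C) ∧ ∀ P ρ Q σ, R (P, ρ) (Q, σ) →
    (∀ α P' ρ', ¬ α.IsInput → Step Δ (P, ρ) α (P', ρ') →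
      ∃ Q' σ', Step Δ (Q, σ) α (Q', σ') ∧ R (P', ρ') (Q', σ')) ∧
    InputClause Δ R P ρ Q σ

/-- Strong bisimilarity of processes. -/
def Bisim (P Q : Proc S) : Prop :=
  ∀ ρ : State S, ∃ R, IsBisim Δ R ∧ R (P, ρ) (Q, ρ)

/-- Strong `lam`-bisimulations. -/
def IsApproxBisim (lam : ℝ≥0) (R : Conf S → Conf S → Prop) : Prop :=
  (∀ C C', R C C' → R C' C) ∧
  (∀ (P : Proc S) (ρ σ : State S), traceDist ρ σ ≤ lam → R (P, ρ) (P, σ)) ∧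
  ∀ P ρ Q σ, R (P, ρ) (Q, σ) →
    (∀ α P', (α = .tau ∨ ∃ c x, α = .out c x) → Step Δ (P, ρ) α (P', ρ) →
      ∃ Q', Step Δ (Q, σ) α (Q', σ) ∧ R (P', ρ) (Q', σ)) ∧
    (∀ X E P' ρ', Step Δ (P, ρ) (.op X E) (P', ρ') →
      ∃ F Q' σ', Step Δ (Q, σ) (.op X F) (Q', σ') ∧ R (P', ρ') (Q', σ') ∧
        diamondDist E F ≤ lam) ∧
    InputClause Δ R P ρ Q σ

/-- Strong `lam`-bisimilarity of processes. -/
def ApproxBisim (lam : ℝ≥0) (P Q : Proc S) : Prop :=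
  ∀ ρ : State S, ∃ R, IsApproxBisim Δ lam R ∧ R (P, ρ) (Q, ρ)

end

/-! ### Operation reduction -/

/-- The union `X₁ ∪ … ∪ Xₙ` for a string of operations `E⁽¹⁾[X₁] … E⁽ⁿ⁾[Xₙ]`. -/
noncomputable def opSupport {S : Sig.{u, v}} (l : List (Σ X : Finset S.Var, SuperOp (Idx S X))) :
    Finset S.Var :=
  l.foldr (fun p Y => p.1 ∪ Y) ∅

/-- `(E⁽ⁿ⁾ ⊗ I_{X - Xₙ}) ∘ … ∘ (E⁽¹⁾ ⊗ I_{X - X₁})` for a string of operations `E⁽¹⁾[X₁] … E⁽ⁿ⁾[Xₙ]`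
with all `Xᵢ ⊆ X`. -/
noncomputable def opComp {S : Sig.{u, v}} (X : Finset S.Var) :
    ∀ l : List (Σ X : Finset S.Var, SuperOp (Idx S X)), opSupport l ⊆ X → SuperOp (Idx S X)
  | [], _ => SuperOp.id _
  | p :: l, h =>
    (opComp X l (Finset.union_subset_right h)).comp
      (p.2.extend (subLens S (Finset.union_subset_left h)))

/-- Operation reduction between strings of actions. -/
inductive StrRed {S : Sig.{u, v}} : List (Act S) → List (Act S) → Prop
  | oper (l : List (Σ X : Finset S.Var, SuperOp (Idx S X))) (hl : l ≠ []) :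
      StrRed (l.map fun p => Act.op p.1 p.2)
        [Act.op (opSupport l) (opComp (opSupport l) l (Finset.Subset.refl _))]
  | struct {t t' : List (Act S)} (t₁ t₂ : List (Act S)) (h : StrRed t t') :
      StrRed (t₁ ++ t ++ t₂) (t₁ ++ t' ++ t₂)

/-- Operation reduction between processes. -/
inductive Red {S : Sig.{u, v}} : Raw S → Raw S → Prop
  | act {s t : List (Act S)} (P : Raw S) (h : StrRed s t) : Red (.pres s P) (.pres t P)
  | pre {P P' : Raw S} (α : Act S) (h : Red P P') : Red (.pre α P) (.pre α P')
  | sumL {P P' : Raw S} (Q : Raw S) (h : Red P P') : Red (.sum P Q) (.sum P' Q)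
  | sumR {Q Q' : Raw S} (P : Raw S) (h : Red Q Q') : Red (.sum P Q) (.sum P Q')
  | parL {P P' : Raw S} (Q : Raw S) (h : Red P P') : Red (.par P Q) (.par P' Q)
  | parR {Q Q' : Raw S} (P : Raw S) (h : Red Q Q') : Red (.par P Q) (.par P Q')
  | restr {P P' : Raw S} (L : Set S.Chan) (h : Red P P') : Red (.restr P L) (.restr P' L)
  | refl (P : Raw S) : Red P P
  | trans {P Q R : Raw S} (h₁ : Red P Q) (h₂ : Red Q R) : Red P R

section
variable {S : Sig.{u, v}} (Δ : Defn S)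

/-- The relation `≃`. -/
def RedEq (P Q : Proc S) : Prop :=
  ∃ P₁ P₂ Q₁ Q₂ : Proc S, Bisim Δ P P₁ ∧ Red P₁.1 P₂.1 ∧ Bisim Δ Q Q₁ ∧ Red Q₁.1 Q₂.1 ∧
    Bisim Δ P₂ Q₂

/-- Strong reduction-bisimilarity. -/
def RedBisim : Proc S → Proc S → Prop := Relation.TransGen (RedEq Δ)

/-- `RedChain Δ s P Q`: there are `n ≥ 0`, processes `Rᵢ, Rᵢ'` and numbers `lamᵢ ≥ 0` with sum `s`
such that `P` is linked to `Q` by strong reduction-bisimilarities alternating with strong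
`lamᵢ`-bisimilarities of `Rᵢ` and `Rᵢ'`, beginning and ending with the former. -/
inductive RedChain : ℝ≥0 → Proc S → Proc S → Prop
  | last {P Q : Proc S} (h : RedBisim Δ P Q) : RedChain 0 P Q
  | step {P R R' Q : Proc S} {lam s : ℝ≥0} (h₁ : RedBisim Δ P R) (h₂ : ApproxBisim Δ lam R R')
      (h₃ : RedChain s R' Q) : RedChain (lam + s) P Q

/-- Strong `lam`-reduction-bisimilarity. -/
def ApproxRedBisim (lam : ℝ≥0) (P Q : Proc S) : Prop :=
  ∃ s ≤ lam, RedChain Δ s P Q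

/-- The strong reduction-bisimulation distance; the infimum of the empty set is `∞`. -/
noncomputable def Dsrb (P Q : Proc S) : ℝ≥0∞ :=
  ⨅ (lam : ℝ≥0) (_ : ApproxRedBisim Δ lam P Q), (lam : ℝ≥0∞)

end

open Classical in
/-- `0` if `X = Y`, and `∞` otherwise. -/
noncomputable def eta {S : Sig.{u, v}} (X Y : Finset S.Var) : ℝ≥0∞ := if X = Y then 0 else ∞

open Classical in
/-- The diamond distance of operations on `H_X` and on `H_Y`. It is meaningful for `X = Y` only;
otherwise the value is immaterial. -/
noncomputable def opDist {S : Sig.{u, v}} {X Y : Finset S.Var} (E : SuperOp (Idx S X))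
    (F : SuperOp (Idx S Y)) : ℝ≥0∞ :=
  if h : X = Y then diamondDist (h ▸ E) F else 0

end QCCS

namespace QCCS

/-! ### Distances of super-operators -/

/-! The state of the environment never enables or blocks a transition. It is only carried along:
`Trans` is the state-free system `Lts` together with the map `Act.run` on states. Moreover, neither
kind of bisimulation constrains the states it relates beyond requiring that certain pairs be
present. Hence strong bisimilarity and strong λ-bisimilarity are both instances of one relation on
terms, `MBisim Δ M`, in which labels are matched by equality or by `Near lam` (`bisim_iff`,
`approxBisim_iff`).

`MBisim` is closed under substitution by definition and is preserved by every constructor. The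
delicate case is parallel composition (`mBisim_par`): inputs need to be matched only for variables
free in neither partner, and a variable received from the other component is always of this kind,
since components share no free variables. Operation reduction is preserved by constructors by
definition and by substitutions through `Red.subst`.

The distance is an infimum of total weights of chains. Concatenation and reversal of chains give the
pseudo-metric laws. For non-expansiveness one would put every process of a chain into the context,
at the same weight. The obstacle is that processes in the middle of a chain may have free variables
that the context forbids, such as `x` for `c!x.[·]` or those of `R` for `[·] ‖ R`. Since every type
has infinitely many variables, the whole chain can be renamed by a substitution that moves its
finitely many free variables out of the forbidden set (`exists_subst_avoiding`). This substitution
fixes the free variables of the endpoints, so it changes these only in bound variables, hence only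
up to strong bisimilarity (`mBisim_subst_of_fix`). The result is `Context.redChain`.

For operation prefixes, the super-operator is replaced first, at the cost of one approximate step,
and the continuation afterwards. -/

/-- The multiset of roots does not depend on an enumeration of eigenvalues, so invariance under
relabelling of the basis and under sign change reduces to facts about characteristic polynomials. -/
theorem traceNorm_eq_roots {ι : Type*} [Fintype ι] [DecidableEq ι] (A : Matrix ι ι ℂ) :
    traceNorm A = ((A.conjTranspose * A).charpoly.roots.map fun z => √z.re).sum := by
  rw [(Matrix.isHermitian_conjTranspose_mul_self A).roots_charpoly_eq_eigenvalues, Multiset.map_map]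
  simp [traceNorm]

theorem traceNorm_submatrix {ι κ : Type*} [Fintype ι] [DecidableEq ι] [Fintype κ] [DecidableEq κ]
    (e : κ ≃ ι) (A : Matrix ι ι ℂ) : traceNorm (A.submatrix e e) = traceNorm A := by
  rw [traceNorm_eq_roots, traceNorm_eq_roots, Matrix.conjTranspose_submatrix,
    Matrix.submatrix_mul_equiv]
  have := Matrix.charpoly_reindex e.symm (A.conjTranspose * A)
  rw [Matrix.reindex_apply] at this
  simp only [Equiv.symm_symm] at this
  rw [this]

theorem traceNorm_neg {ι : Type*} [Fintype ι] [DecidableEq ι] (A : Matrix ι ι ℂ) :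
    traceNorm (-A) = traceNorm A := by
  rw [traceNorm_eq_roots, traceNorm_eq_roots, Matrix.conjTranspose_neg, neg_mul_neg]

theorem traceNorm_zero {ι : Type*} [Fintype ι] [DecidableEq ι] :
    traceNorm (0 : Matrix ι ι ℂ) = 0 := by
  simp [traceNorm_eq_roots, Matrix.charpoly_zero, Multiset.map_nsmul, Multiset.sum_nsmul]

theorem diamondDist_self {ι : Type*} [Fintype ι] [DecidableEq ι] (E : SuperOp ι) :
    diamondDist E E = 0 := by
  simp [diamondDist, traceNorm_zero]

theorem diamondDist_comm {ι : Type*} [Fintype ι] [DecidableEq ι] (E F : SuperOp ι) :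
    diamondDist E F = diamondDist F E := by
  simp only [diamondDist]
  refine iSup_congr fun n => iSup_congr fun ρ => iSup_congr fun _ => ?_
  rw [← traceNorm_neg, neg_sub]

/-- Relabelling the basis turns each test state for the renamed operations into a test state for the
original ones with the same auxiliary space. This keeps `Near lam` stable under substitution. -/
theorem diamondDist_reindex_le {ι κ : Type*} [Fintype ι] [DecidableEq ι] [Fintype κ]
    [DecidableEq κ] (e : ι ≃ κ) (E F : SuperOp ι) :
    diamondDist (E.reindex e) (F.reindex e) ≤ diamondDist E F := by
  refine iSup_le fun n => iSup_le fun ρ => iSup_le fun hρ => ?_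
  set e' : ι × Fin n ≃ κ × Fin n := e.prodCongr (Equiv.refl _)
  have hρ' : IsPDens (ρ.submatrix e' e') := by
    refine ⟨hρ.1.submatrix _, ?_⟩
    have : (ρ.submatrix e' e').trace = ρ.trace := Equiv.sum_comp e' (fun i => ρ i i)
    rw [this]
    exact hρ.2
  refine le_trans (le_of_eq ?_) (le_iSup₂_of_le n (ρ.submatrix e' e') (le_iSup_of_le hρ' le_rfl))
  rw [← traceNorm_submatrix e']
  congr 3
  ext p q
  simp [tensorId, SuperOp.reindex, e', Matrix.reindexLinearEquiv, Matrix.submatrix]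

theorem SuperOp.ext_toLin {ι : Type*} [Fintype ι] {E F : SuperOp ι} (h : E.toLin = F.toLin) :
    E = F := by
  cases E; cases F; cases h; rfl

theorem SuperOp.reindex_refl {ι : Type*} [Fintype ι] (E : SuperOp ι) :
    E.reindex (Equiv.refl ι) = E :=
  SuperOp.ext_toLin (by ext; rfl)

theorem SuperOp.reindex_reindex {ι κ μ : Type*} [Fintype ι] [Fintype κ] [Fintype μ] (e : ι ≃ κ)
    (e' : κ ≃ μ) (E : SuperOp ι) : (E.reindex e).reindex e' = E.reindex (e.trans e') :=
  SuperOp.ext_toLin (by ext; rfl)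

/-! ### The group of substitutions -/

variable {S : Sig.{u, v}}

/-- The index types over `Y` and `Y'` agree only propositionally, so the two equivalences are
compared by the numerical values of their components. -/
theorem Act.op_reindex_eq {X Y Y' : Finset S.Var} (E : SuperOp (Idx S X)) (e : Idx S X ≃ Idx S Y)
    (e' : Idx S X ≃ Idx S Y') (h : Y = Y')
    (he : ∀ k y (hy : y ∈ Y) (hy' : y ∈ Y'), (e k ⟨y, hy⟩ : ℕ) = e' k ⟨y, hy'⟩) :
    Act.op Y (E.reindex e) = Act.op Y' (E.reindex e') := by
  subst h
  congr 2
  ext k y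
  exact he k y.1 y.2 y.2

namespace Subst

@[ext] theorem ext {f g : Subst S} (h : ∀ x, f.perm x = g.perm x) : f = g := by
  cases f; cases g
  congr
  exact Equiv.ext h

/-- The identity substitution. -/
def refl (S : Sig.{u, v}) : Subst S := ⟨Equiv.refl _, fun _ => rfl, by simp⟩

/-- The inverse substitution. -/
def symm (f : Subst S) : Subst S where
  perm := f.perm.symm
  dim_eq x := by rw [← f.dim_eq, Equiv.apply_symm_apply]
  finite := f.finite.subset fun x hx => by
    intro h
    exact hx (by rw [Equiv.symm_apply_eq, h])

/-- The substitution `f` followed by `g`. -/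
def trans (f g : Subst S) : Subst S where
  perm := f.perm.trans g.perm
  dim_eq x := by simp [g.dim_eq, f.dim_eq]
  finite := (f.finite.union g.finite).subset fun x hx => by
    by_contra h
    simp only [Set.mem_union, Set.mem_ofPred_eq, not_or, not_not] at h
    exact hx (by simp [h.1, h.2])

@[simp] theorem refl_perm (x : S.Var) : (refl S).perm x = x := rfl
@[simp] theorem trans_perm (f g : Subst S) (x : S.Var) :
    (f.trans g).perm x = g.perm (f.perm x) := rfl
@[simp] theorem symm_perm_perm (f : Subst S) (x : S.Var) : f.symm.perm (f.perm x) = x :=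
  f.perm.symm_apply_apply x
@[simp] theorem perm_symm_perm (f : Subst S) (x : S.Var) : f.perm (f.symm.perm x) = x :=
  f.perm.apply_symm_apply x
@[simp] theorem swap_perm (x y z : S.Var) (h : S.dim y = S.dim x) :
    (swap x y h).perm z = Equiv.swap x y z := rfl

@[simp] theorem trans_symm (f : Subst S) : f.trans f.symm = refl S := by ext; simp
@[simp] theorem symm_trans (f : Subst S) : f.symm.trans f = refl S := by ext; simp
@[simp] theorem swap_self (x : S.Var) (h : S.dim x = S.dim x) : swap x x h = refl S := by
  ext; simp

/-- Conjugating a transposition gives the transposition of the images; this is what makes the input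
rule equivariant. -/
theorem swap_trans (f : Subst S) (x y : S.Var) (h : S.dim y = S.dim x)
    (h' : S.dim (f.perm y) = S.dim (f.perm x)) :
    (swap x y h).trans f = f.trans (swap (f.perm x) (f.perm y) h') := by
  ext z
  simp [f.perm.injective.swap_apply]

@[simp] theorem mem_image (f : Subst S) (X : Finset S.Var) (x : S.Var) :
    x ∈ f.image X ↔ f.symm.perm x ∈ X := by
  constructor
  · intro h
    obtain ⟨y, hy, rfl⟩ := Finset.mem_map.1 h
    simpa using hy
  · intro h
    exact Finset.mem_map.2 ⟨_, h, by simp⟩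

theorem onAct_congr {f g : Subst S} {α : Act S} (h : ∀ x ∈ α.preFv ∅, f.perm x = g.perm x)
    (hα : ¬ α.IsInput) : f.onAct α = g.onAct α := by
  cases α with
  | tau => rfl
  | inp c x => exact absurd trivial hα
  | out c x => simp [onAct, h x (by simp [Act.preFv])]
  | op X E =>
    have h' : ∀ x ∈ X, f.perm x = g.perm x := fun x hx => h x (by simp [Act.preFv, hx])
    refine Act.op_reindex_eq E _ _ (Finset.ext fun z => ?_) fun k y hy hy' => ?_
    · simp only [image, Finset.mem_map, Equiv.coe_toEmbedding]
      exact ⟨fun ⟨x, hx, hz⟩ => ⟨x, hx, h' x hx ▸ hz⟩, fun ⟨x, hx, hz⟩ => ⟨x, hx, h' x hx ▸ hz⟩⟩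
    obtain ⟨x, hx, rfl⟩ := Finset.mem_map.1 hy
    have e : ∀ z z' : X, z = z' → (k z : ℕ) = k z' := fun z z' hz => by rw [hz]
    refine e _ _ (Subtype.ext ?_)
    change f.perm.symm (f.perm x) = g.perm.symm (f.perm x)
    rw [Equiv.symm_apply_apply, h' x hx, Equiv.symm_apply_apply]

@[simp] theorem onAct_refl (α : Act S) : (refl S).onAct α = α := by
  cases α with
  | op X E =>
    conv_rhs => rw [← E.reindex_refl]
    exact Act.op_reindex_eq E _ _ (by ext; simp; rfl) fun k y hy hy' => rfl
  | _ => rfl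

theorem onAct_onAct (f g : Subst S) (α : Act S) : g.onAct (f.onAct α) = (f.trans g).onAct α := by
  cases α with
  | op X E =>
    simp only [onAct]
    rw [SuperOp.reindex_reindex]
    exact Act.op_reindex_eq E _ _ (by ext; simp; rfl) fun k y hy hy' => rfl
  | _ => rfl

@[simp] theorem isInput_onAct (f : Subst S) (α : Act S) : (f.onAct α).IsInput ↔ α.IsInput := by
  cases α <;> rfl

@[simp] theorem chanMem_onAct (f : Subst S) (L : Set S.Chan) (α : Act S) :
    (f.onAct α).ChanMem L ↔ α.ChanMem L := by
  cases α <;> rfl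

end Subst

namespace Raw

@[simp] theorem subst_refl (P : Raw S) : P.subst (.refl S) = P := by
  induction P with
  | const A y => rfl
  | _ => simp_all [subst]

theorem subst_subst (f g : Subst S) (P : Raw S) :
    (P.subst f).subst g = P.subst (f.trans g) := by
  induction P with
  | const A y => rfl
  | _ => simp_all [subst, Subst.onAct_onAct]

end Raw

namespace Proc

@[simp] theorem subst_refl (P : Proc S) : P.subst (.refl S) = P := Subtype.ext P.1.subst_refl

theorem fv_subst (f : Subst S) (P : Proc S) : (P.subst f).fv = f.image P.fv := P.1.fv_subst f

end Proc

/-! ### The transition system without states -/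

/-- The transitions of processes. They do not depend on the state of the environment. -/
inductive Lts (Δ : Defn S) : Raw S → Act S → Raw S → Prop
  | act {α : Act S} (P : Raw S) (hα : ¬ α.IsInput) : Lts Δ (.pre α P) α P
  | input (c : S.Chan) (x y : S.Var) (h : S.dim y = S.dim x) (P : Raw S)
      (hy : y ∉ (Raw.pre (.inp c x) P).fv) :
      Lts Δ (.pre (.inp c x) P) (.inp c y) (P.subst (.swap x y h))
  | choiceL {P P' : Raw S} {α : Act S} (Q : Raw S) (h : Lts Δ P α P') : Lts Δ (.sum P Q) α P'
  | choiceR {Q Q' : Raw S} {α : Act S} (P : Raw S) (h : Lts Δ Q α Q') : Lts Δ (.sum P Q) α Q'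
  | intlL {P Q P' : Raw S} {α : Act S} (h : Lts Δ P α P')
      (hα : ∀ c x, α = .inp c x → x ∉ Q.fv) : Lts Δ (.par P Q) α (.par P' Q)
  | intlR {P Q Q' : Raw S} {α : Act S} (h : Lts Δ Q α Q')
      (hα : ∀ c x, α = .inp c x → x ∉ P.fv) : Lts Δ (.par P Q) α (.par P Q')
  | commL {P Q P' Q' : Raw S} {c : S.Chan} {x : S.Var} (h₁ : Lts Δ P (.inp c x) P')
      (h₂ : Lts Δ Q (.out c x) Q') : Lts Δ (.par P Q) .tau (.par P' Q')
  | commR {P Q P' Q' : Raw S} {c : S.Chan} {x : S.Var} (h₁ : Lts Δ P (.out c x) P')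
      (h₂ : Lts Δ Q (.inp c x) Q') : Lts Δ (.par P Q) .tau (.par P' Q')
  | restr {P P' : Raw S} {L : Set S.Chan} {α : Act S} (h : Lts Δ P α P') (hα : ¬ α.ChanMem L) :
      Lts Δ (.restr P L) α (.restr P' L)
  | defn {A : S.Scheme} {y : Fin (S.arity A) ↪ S.Var} {f : Subst S} {P' : Raw S} {α : Act S}
      (hf : ∀ i, f.perm (Δ.params A i) = y i) (h : Lts Δ ((Δ.body A).1.subst f) α P') :
      Lts Δ (.const A y) α P'

/-- The effect of an action on the environment. -/
noncomputable def Act.run : Act S → State S → State S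
  | .op X E, ρ => E.cyl (envLens S X) ρ
  | _, ρ => ρ

section
variable {Δ : Defn S}

theorem Trans.lts {P P' : Raw S} {α : Act S} {ρ ρ' : State S} (h : Trans Δ P ρ α P' ρ') :
    Lts Δ P α P' ∧ ρ' = α.run ρ := by
  induction h with
  | tau P ρ => exact ⟨.act P id, rfl⟩
  | oper X E P ρ => exact ⟨.act P id, rfl⟩
  | input c x y h P ρ hy => exact ⟨.input c x y h P hy, rfl⟩
  | output c x P ρ => exact ⟨.act P id, rfl⟩
  | choiceL h ih => exact ⟨.choiceL _ ih.1, ih.2⟩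
  | choiceR h ih => exact ⟨.choiceR _ ih.1, ih.2⟩
  | intlInL h hx ih => exact ⟨.intlL ih.1 (by rintro c x ⟨⟩; exact hx), ih.2⟩
  | intlInR h hx ih => exact ⟨.intlR ih.1 (by rintro c x ⟨⟩; exact hx), ih.2⟩
  | intlL h hα ih => exact ⟨.intlL ih.1 (by rintro c x rfl; exact absurd trivial hα), ih.2⟩
  | intlR h hα ih => exact ⟨.intlR ih.1 (by rintro c x rfl; exact absurd trivial hα), ih.2⟩
  | commL h₁ h₂ ih₁ ih₂ => exact ⟨.commL ih₁.1 ih₂.1, rfl⟩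
  | commR h₁ h₂ ih₁ ih₂ => exact ⟨.commR ih₁.1 ih₂.1, rfl⟩
  | restr h hα ih => exact ⟨.restr ih.1 hα, ih.2⟩
  | defn hf h ih => exact ⟨.defn hf ih.1, ih.2⟩

/-! ### Renaming, free variables and well-formedness along transitions -/

namespace Lts

theorem trans {P P' : Raw S} {α : Act S} (h : Lts Δ P α P') (ρ : State S) :
    Trans Δ P ρ α P' (α.run ρ) := by
  induction h generalizing ρ with
  | @act α P hα =>
    cases α with
    | tau => exact .tau P ρ
    | op X E => exact .oper X E P ρ
    | inp c x => exact absurd trivial hα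
    | out c x => exact .output c x P ρ
  | input c x y h P hy => exact .input c x y h P ρ hy
  | choiceL Q h ih => exact .choiceL (ih ρ)
  | choiceR P h ih => exact .choiceR (ih ρ)
  | @intlL P Q P' α h hα ih =>
    cases α with
    | inp c x => exact .intlInL (ih ρ) (hα c x rfl)
    | _ => exact .intlL (ih ρ) id
  | @intlR P Q P' α h hα ih =>
    cases α with
    | inp c x => exact .intlInR (ih ρ) (hα c x rfl)
    | _ => exact .intlR (ih ρ) id
  | commL h₁ h₂ ih₁ ih₂ => exact .commL (ih₁ ρ) (ih₂ ρ)
  | commR h₁ h₂ ih₁ ih₂ => exact .commR (ih₁ ρ) (ih₂ ρ)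
  | restr h hα ih => exact .restr (ih ρ) hα
  | defn hf h ih => exact .defn hf (ih ρ)

theorem subst {P P' : Raw S} {α : Act S} (h : Lts Δ P α P') (f : Subst S) :
    Lts Δ (P.subst f) (f.onAct α) (P'.subst f) := by
  have hfv : ∀ (x : S.Var) (Q : Raw S), x ∉ Q.fv → f.perm x ∉ (Q.subst f).fv := fun x Q hx => by
    simpa [Raw.fv_subst] using hx
  induction h with
  | act P hα => exact .act _ (by simpa using hα)
  | input c x y h P hy =>
    have h' : S.dim (f.perm y) = S.dim (f.perm x) := by rw [f.dim_eq, f.dim_eq, h]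
    rw [Raw.subst_subst, Subst.swap_trans f x y h h', ← Raw.subst_subst]
    exact .input c _ _ h' _ (hfv y _ hy)
  | choiceL Q h ih => exact .choiceL _ ih
  | choiceR P h ih => exact .choiceR _ ih
  | @intlL P Q P' α h hα ih =>
    refine .intlL ih fun c x hx => ?_
    cases α <;> cases hx
    exact hfv _ _ (hα _ _ rfl)
  | @intlR P Q P' α h hα ih =>
    refine .intlR ih fun c x hx => ?_
    cases α <;> cases hx
    exact hfv _ _ (hα _ _ rfl)
  | commL h₁ h₂ ih₁ ih₂ => exact .commL ih₁ ih₂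
  | commR h₁ h₂ ih₁ ih₂ => exact .commR ih₁ ih₂
  | restr h hα ih => exact .restr ih (by simpa using hα)
  | @defn A y g P' α hg h ih =>
    -- The rule for constants admits any substitution taking the parameters to the arguments, so the
    -- composite with `f` serves for the renamed arguments.
    refine .defn (f := g.trans f) (fun i => ?_) (Raw.subst_subst g f _ ▸ ih)
    simp [hg]

/-- Only an input can introduce a free variable, namely the one received. For other labels, `α.preFv
∅` is the set of variables occurring in the label. -/
theorem fv_subset {P P' : Raw S} {α : Act S} (h : Lts Δ P α P') :
    (∀ x ∈ P'.fv, x ∈ P.fv ∨ ∃ c, α = .inp c x) ∧ (α.IsInput ∨ α.preFv ∅ ⊆ P.fv) := by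
  induction h with
  | @act α P hα =>
    cases α with
    | inp c x => exact absurd trivial hα
    | _ => simp +contextual [Raw.fv, Act.preFv]
  | input c x y h P hy =>
    refine ⟨fun z hz => ?_, .inl trivial⟩
    simp only [Raw.fv_subst, Subst.mem_image] at hz
    change Equiv.swap x y z ∈ P.fv at hz
    simp only [Raw.fv, Act.preFv, Finset.mem_erase] at hy ⊢
    rcases eq_or_ne z y with rfl | hzy
    · exact .inr ⟨c, rfl⟩
    rcases eq_or_ne z x with rfl | hzx
    · rw [Equiv.swap_apply_left] at hz
      exact absurd ⟨hzy.symm, hz⟩ hy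
    · rw [Equiv.swap_apply_of_ne_of_ne hzx hzy] at hz
      exact .inl ⟨hzx, hz⟩
  | choiceL Q h ih => grind [Raw.fv]
  | choiceR P h ih => grind [Raw.fv]
  | intlL h hα ih => grind [Raw.fv]
  | intlR h hα ih => grind [Raw.fv]
  | @commL P Q P' Q' c x h₁ h₂ ih₁ ih₂ =>
    have hx : x ∈ Q.fv := by simpa [Act.IsInput, Act.preFv] using ih₂.2
    refine ⟨fun z hz => .inl ?_, .inr (by simp [Act.preFv])⟩
    simp only [Raw.fv, Finset.mem_union] at hz ⊢
    rcases hz with hz | hz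
    · rcases ih₁.1 z hz with h | ⟨_, ⟨⟩⟩
      exacts [.inl h, .inr hx]
    · rcases ih₂.1 z hz with h | ⟨_, ⟨⟩⟩
      exact .inr h
  | @commR P Q P' Q' c x h₁ h₂ ih₁ ih₂ =>
    have hx : x ∈ P.fv := by simpa [Act.IsInput, Act.preFv] using ih₁.2
    refine ⟨fun z hz => .inl ?_, .inr (by simp [Act.preFv])⟩
    simp only [Raw.fv, Finset.mem_union] at hz ⊢
    rcases hz with hz | hz
    · rcases ih₁.1 z hz with h | ⟨_, ⟨⟩⟩
      exact .inl h
    · rcases ih₂.1 z hz with h | ⟨_, ⟨⟩⟩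
      exacts [.inr h, .inl hx]
  | restr h hα ih => exact ih
  | @defn A y f P' α hf h ih =>
    have hsub : ((Δ.body A).1.subst f).fv ⊆ (Raw.const A y).fv := fun z hz => by
      rw [Raw.fv_subst, Subst.mem_image] at hz
      obtain ⟨i, -, hi⟩ := Finset.mem_map.1 (Δ.fv_body A hz)
      refine Finset.mem_map.2 ⟨i, Finset.mem_univ _, ?_⟩
      rw [← hf, hi, Subst.perm_symm_perm]
    exact ⟨fun z hz => (ih.1 z hz).imp_left fun h => hsub h, ih.2.imp_right fun h => h.trans hsub⟩

theorem fv_of_not_isInput {P P' : Raw S} {α : Act S} (h : Lts Δ P α P') (hα : ¬ α.IsInput) :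
    P'.fv ⊆ P.fv := fun x hx => (h.fv_subset.1 x hx).resolve_right (by
  rintro ⟨c, rfl⟩; exact hα trivial)

theorem fv_inp {P P' : Raw S} {c : S.Chan} {x : S.Var} (h : Lts Δ P (.inp c x) P') :
    P'.fv ⊆ insert x P.fv := fun z hz => by
  rcases h.fv_subset.1 z hz with h | ⟨_, ⟨⟩⟩ <;> simp [*]

theorem mem_fv_out {P P' : Raw S} {c : S.Chan} {x : S.Var} (h : Lts Δ P (.out c x) P') :
    x ∈ P.fv := by
  simpa [Act.IsInput, Act.preFv] using h.fv_subset.2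

/-- A system that has been sent away is no longer held by the sender: the side condition on `c!x.P`
gives this at the prefix, and disjointness of parallel components carries it upwards. -/
theorem notMem_fv_out {P P' : Raw S} {c : S.Chan} {x : S.Var} (h : Lts Δ P (.out c x) P')
    (hP : P.WF) : x ∉ P'.fv := by
  generalize hα : Act.out c x = α at h
  induction h with
  | act P h => subst hα; exact hP.2
  | input | commL | commR => cases hα
  | choiceL Q h ih => exact ih hP.1 hα
  | choiceR Q h ih => exact ih hP.2 hα
  | intlL h _ ih =>
    subst hα
    have := Finset.disjoint_left.1 hP.2.2 h.mem_fv_out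
    simp [Raw.fv, ih hP.1 rfl, this]
  | intlR h _ ih =>
    subst hα
    have := Finset.disjoint_right.1 hP.2.2 h.mem_fv_out
    simp [Raw.fv, ih hP.2.1 rfl, this]
  | restr h _ ih => exact ih hP hα
  | defn hf h ih => exact ih ((Δ.body _).2.subst _) hα

/-- The point is disjointness of parallel components. In a communication the receiver may gain `x`,
but the sender has lost it by `notMem_fv_out`. -/
theorem wf {P P' : Raw S} {α : Act S} (h : Lts Δ P α P') (hP : P.WF) : P'.WF := by
  induction h with
  | act P h => exact hP.1
  | input c x y h P hy => exact hP.1.subst _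
  | choiceL Q h ih => exact ih hP.1
  | choiceR Q h ih => exact ih hP.2
  | intlL h hα ih =>
    refine ⟨ih hP.1, hP.2.1, Finset.disjoint_left.2 fun z hz hz' => ?_⟩
    rcases h.fv_subset.1 z hz with hz | ⟨c, rfl⟩
    · exact Finset.disjoint_left.1 hP.2.2 hz hz'
    · exact hα _ _ rfl hz'
  | intlR h hα ih =>
    refine ⟨hP.1, ih hP.2.1, Finset.disjoint_right.2 fun z hz hz' => ?_⟩
    rcases h.fv_subset.1 z hz with hz | ⟨c, rfl⟩
    · exact Finset.disjoint_right.1 hP.2.2 hz hz'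
    · exact hα _ _ rfl hz'
  | commL h₁ h₂ ih₁ ih₂ =>
    refine ⟨ih₁ hP.1, ih₂ hP.2.1, Finset.disjoint_left.2 fun z hz hz' => ?_⟩
    rcases Finset.mem_insert.1 (h₁.fv_inp hz) with rfl | hz
    · exact h₂.notMem_fv_out hP.2.1 hz'
    · exact Finset.disjoint_left.1 hP.2.2 hz (h₂.fv_of_not_isInput id hz')
  | commR h₁ h₂ ih₁ ih₂ =>
    refine ⟨ih₁ hP.1, ih₂ hP.2.1, Finset.disjoint_left.2 fun z hz hz' => ?_⟩
    rcases Finset.mem_insert.1 (h₂.fv_inp hz') with rfl | hz'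
    · exact h₁.notMem_fv_out hP.1 hz
    · exact Finset.disjoint_left.1 hP.2.2 (h₁.fv_of_not_isInput id hz) hz'
  | restr h _ ih => exact ih hP
  | defn hf h ih => exact ih ((Δ.body _).2.subst _)

end Lts

/-! ### Equivalence up to bound variables -/

/-- `Alpha f P Q`: the term `Q` is, up to bound variables, the result of replacing the free
variables of `P` according to `f`. -/
inductive Alpha : Subst S → Raw S → Raw S → Prop
  | const (f : Subst S) (A : S.Scheme) (y y' : Fin (S.arity A) ↪ S.Var)
      (h : ∀ i, y' i = f.perm (y i)) : Alpha f (.const A y) (.const A y')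
  | nil (f : Subst S) : Alpha f .nil .nil
  | act {f : Subst S} {α β : Act S} {P Q : Raw S} (hα : ¬ α.IsInput) (hβ : β = f.onAct α)
      (h : Alpha f P Q) : Alpha f (.pre α P) (.pre β Q)
  | inp {f g : Subst S} (c : S.Chan) {x x' : S.Var} {P Q : Raw S} (hx : x' = g.perm x)
      (hg : ∀ z ∈ P.fv, z ≠ x → g.perm z = f.perm z) (h : Alpha g P Q) :
      Alpha f (.pre (.inp c x) P) (.pre (.inp c x') Q)
  | sum {f : Subst S} {P P' Q Q' : Raw S} (h₁ : Alpha f P P') (h₂ : Alpha f Q Q') :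
      Alpha f (.sum P Q) (.sum P' Q')
  | par {f : Subst S} {P P' Q Q' : Raw S} (h₁ : Alpha f P P') (h₂ : Alpha f Q Q') :
      Alpha f (.par P Q) (.par P' Q')
  | restr {f : Subst S} {P P' : Raw S} (L : Set S.Chan) (h : Alpha f P P') :
      Alpha f (.restr P L) (.restr P' L)

namespace Alpha

theorem of_subst (f : Subst S) (P : Raw S) : Alpha f P (P.subst f) := by
  induction P with
  | const A y => exact .const f A y _ fun _ => rfl
  | nil => exact .nil f
  | pre α P ih =>
    by_cases hα : α.IsInput
    · cases α with
      | inp c x => exact .inp c rfl (fun _ _ _ => rfl) ih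
      | _ => exact hα.elim
    · exact .act hα rfl ih
  | sum P Q ihP ihQ => exact .sum ihP ihQ
  | par P Q ihP ihQ => exact .par ihP ihQ
  | restr P L ih => exact .restr L ih

theorem preFv_eq (α : Act S) (hα : ¬ α.IsInput) (F : Finset S.Var) :
    α.preFv F = F ∪ α.preFv ∅ := by
  cases α with
  | inp c x => exact absurd trivial hα
  | out c x => simp [Act.preFv]
  | _ => simp [Act.preFv]

/-- Only the values of `f` on free variables matter, because the `inp` rule allows a different
substitution below each binder. -/
theorem congr {f f' : Subst S} {P Q : Raw S} (h : Alpha f P Q)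
    (hf : ∀ z ∈ P.fv, f.perm z = f'.perm z) : Alpha f' P Q := by
  induction h generalizing f' with
  | const f A y y' h => exact .const _ A y y' fun i => by rw [h, hf _ (by simp [Raw.fv])]
  | nil f => exact .nil _
  | @act f α β P Q hα hβ h ih =>
    rw [Raw.fv, preFv_eq α hα] at hf
    simp only [Finset.mem_union] at hf
    exact .act hα (hβ.trans (Subst.onAct_congr (fun x hx => hf x (.inr hx)) hα))
      (ih fun z hz => hf z (.inl hz))
  | inp c hx hg h ih =>
    exact .inp c hx (fun z hz hne => (hg z hz hne).trans (hf z (by simp [Raw.fv, Act.preFv, *]))) h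
  | sum h₁ h₂ ih₁ ih₂ =>
    simp only [Raw.fv, Finset.mem_union] at hf
    exact .sum (ih₁ fun z hz => hf z (.inl hz)) (ih₂ fun z hz => hf z (.inr hz))
  | par h₁ h₂ ih₁ ih₂ =>
    simp only [Raw.fv, Finset.mem_union] at hf
    exact .par (ih₁ fun z hz => hf z (.inl hz)) (ih₂ fun z hz => hf z (.inr hz))
  | restr L h ih => exact .restr L (ih hf)

theorem fv_eq {f : Subst S} {P Q : Raw S} (h : Alpha f P Q) : Q.fv = f.image P.fv := by
  induction h with
  | const f A y y' h =>
    obtain rfl : y' = y.trans f.perm.toEmbedding := Function.Embedding.ext h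
    simp [Raw.fv, Subst.image, Finset.map_map]
  | nil f => simp [Raw.fv, Subst.image]
  | @act f α β P Q hα hβ h ih =>
    subst hβ
    cases α with
    | inp c x => exact absurd trivial hα
    | _ => simp [Raw.fv, Act.preFv, ih, Subst.onAct, Subst.image, Finset.map_union]
  | @inp f g c x x' P Q hx hg h ih =>
    subst hx
    simp only [Raw.fv, Act.preFv, ih, Subst.image]
    ext z
    simp only [Finset.mem_erase, Finset.mem_map, Equiv.coe_toEmbedding]
    constructor
    · rintro ⟨hz, w, hw, rfl⟩
      have hne : w ≠ x := fun h => hz (by rw [h])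
      exact ⟨w, ⟨hne, hw⟩, (hg w hw hne).symm⟩
    · rintro ⟨w, ⟨hne, hw⟩, rfl⟩
      rw [← hg w hw hne]
      exact ⟨fun h => hne (g.perm.injective h), w, hw, rfl⟩
  | sum h₁ h₂ ih₁ ih₂ => simp [Raw.fv, ih₁, ih₂, Subst.image, Finset.map_union]
  | par h₁ h₂ ih₁ ih₂ => simp [Raw.fv, ih₁, ih₂, Subst.image, Finset.map_union]
  | restr L h ih => exact ih

theorem subst_right {f : Subst S} {P Q : Raw S} (h : Alpha f P Q) (g : Subst S) :
    Alpha (f.trans g) P (Q.subst g) := by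
  induction h with
  | const f A y y' h => exact .const _ A y _ fun i => by simp [h]
  | nil f => exact .nil _
  | act hα hβ h ih => exact .act hα (by rw [hβ, Subst.onAct_onAct]) ih
  | inp c hx hg h ih =>
    exact .inp c (by simp [hx]) (fun z hz hne => by simp [hg z hz hne]) ih
  | sum h₁ h₂ ih₁ ih₂ => exact .sum ih₁ ih₂
  | par h₁ h₂ ih₁ ih₂ => exact .par ih₁ ih₂
  | restr L h ih => exact .restr L ih

theorem symm {f : Subst S} {P Q : Raw S} (h : Alpha f P Q) : Alpha f.symm Q P := by
  induction h with
  | const f A y y' h => exact .const _ A _ _ fun i => by simp [h]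
  | nil f => exact .nil _
  | act hα hβ h ih => exact .act (by simpa [hβ] using hα) (by simp [hβ, Subst.onAct_onAct]) ih
  | @inp f g c x x' P Q hx hg h ih =>
    refine .inp c (by simp [hx]) (fun z hz hne => ?_) ih
    rw [h.fv_eq, Subst.mem_image] at hz
    have := hg _ hz (fun e => hne (by rw [hx, ← e, Subst.perm_symm_perm]))
    rw [Subst.perm_symm_perm] at this
    rw [this, Subst.symm_perm_perm, ← this]
  | sum h₁ h₂ ih₁ ih₂ => exact .sum ih₁ ih₂
  | par h₁ h₂ ih₁ ih₂ => exact .par ih₁ ih₂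
  | restr L h ih => exact .restr L ih

theorem subst_left {f : Subst S} {P Q : Raw S} (h : Alpha f P Q) (g : Subst S) :
    Alpha (g.symm.trans f) (P.subst g) Q :=
  (h.symm.subst_right g).symm

theorem mem_fv {f : Subst S} {P Q : Raw S} (h : Alpha f P Q) {x : S.Var} :
    f.perm x ∈ Q.fv ↔ x ∈ P.fv := by
  rw [h.fv_eq, Subst.mem_image, Subst.symm_perm_perm]

/-- Terms equal up to bound variables have the same moves up to the renaming, including the choice
of the received variable. -/
theorem lts {f : Subst S} {P Q P' : Raw S} {α : Act S} (h : Alpha f P Q) (hs : Lts Δ P α P') :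
    ∃ Q', Lts Δ Q (f.onAct α) Q' ∧ Alpha f P' Q' := by
  induction hs generalizing f Q with
  | @act α P hα =>
    cases h with
    | act _ hβ h => subst hβ; exact ⟨_, .act _ (by simpa using hα), h⟩
    | inp => exact absurd trivial hα
  | input c x y hd P hy =>
    have hy' := mt h.mem_fv.1 hy
    cases h with
    | act hα => exact absurd trivial hα
    | @inp _ g _ _ x' _ Q hx hg h =>
      subst hx
      have hd' : S.dim (f.perm y) = S.dim (g.perm x) := by rw [f.dim_eq, g.dim_eq, hd]
      -- Exchanging `x, y` on the left and `g x, f y` on the right turns `g` into a map agreeing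
      -- with `f` on the free variables of the residual: `y` goes through `x` and `g x` to `f y`,
      -- other variables are untouched by both swaps, and `x` itself is not free there unless `x =
      -- y`.
      refine ⟨_, .input c _ _ hd' _ hy', ((h.subst_right _).subst_left _).congr fun z hz => ?_⟩
      rw [Raw.fv_subst, Subst.mem_image] at hz
      change Equiv.swap x y z ∈ P.fv at hz
      change Equiv.swap (g.perm x) (f.perm y) (g.perm (Equiv.swap x y z)) = f.perm z
      rcases eq_or_ne z y with rfl | hzy
      · simp
      rcases eq_or_ne z x with rfl | hzx
      · rw [Equiv.swap_apply_left] at hz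
        exact absurd (Finset.mem_erase.2 ⟨hzy.symm, hz⟩) hy
      · rw [Equiv.swap_apply_of_ne_of_ne hzx hzy] at hz ⊢
        have e := hg z hz hzx
        rw [Equiv.swap_apply_of_ne_of_ne (fun h => hzx (g.perm.injective h)), e]
        rw [e]
        exact fun h => hzy (f.perm.injective h)
  | choiceL R hs ih =>
    cases h with
    | sum h₁ h₂ => obtain ⟨Q', h', ha⟩ := ih h₁; exact ⟨Q', .choiceL _ h', ha⟩
  | choiceR R hs ih =>
    cases h with
    | sum h₁ h₂ => obtain ⟨Q', h', ha⟩ := ih h₂; exact ⟨Q', .choiceR _ h', ha⟩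
  | @intlL P R P' α hs hα ih =>
    cases h with
    | par h₁ h₂ =>
      obtain ⟨Q', h', ha⟩ := ih h₁
      refine ⟨_, .intlL h' fun c x hx => ?_, .par ha h₂⟩
      cases α <;> cases hx
      exact mt h₂.mem_fv.1 (hα _ _ rfl)
  | @intlR P R P' α hs hα ih =>
    cases h with
    | par h₁ h₂ =>
      obtain ⟨Q', h', ha⟩ := ih h₂
      refine ⟨_, .intlR h' fun c x hx => ?_, .par h₁ ha⟩
      cases α <;> cases hx
      exact mt h₁.mem_fv.1 (hα _ _ rfl)
  | commL hs₁ hs₂ ih₁ ih₂ =>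
    cases h with
    | par h₁ h₂ =>
      obtain ⟨Q', h', ha⟩ := ih₁ h₁
      obtain ⟨Q'', h'', ha'⟩ := ih₂ h₂
      exact ⟨_, .commL h' h'', .par ha ha'⟩
  | commR hs₁ hs₂ ih₁ ih₂ =>
    cases h with
    | par h₁ h₂ =>
      obtain ⟨Q', h', ha⟩ := ih₁ h₁
      obtain ⟨Q'', h'', ha'⟩ := ih₂ h₂
      exact ⟨_, .commR h' h'', .par ha ha'⟩
  | restr hs hα ih =>
    cases h with
    | restr L h =>
      obtain ⟨Q', h', ha⟩ := ih h
      exact ⟨_, .restr h' (by simpa using hα), .restr _ ha⟩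
  | @defn A y g P' α hg hs ih =>
    cases h with
    | const _ _ _ y' hy =>
      -- Renaming by `f` the body instantiated through `g` gives an instance of the same body for
      -- the renamed arguments.
      obtain ⟨Q', h', ha⟩ := ih (of_subst f _)
      rw [Raw.subst_subst] at h'
      exact ⟨Q', .defn (fun i => by simp [hy, hg]) h', ha⟩

end Alpha

end

/-! ### Bisimilarity up to a matching of labels -/

/-- Conditions under which a relation `M` may serve to match the labels of transitions: only
operations on the same systems are identified. -/
structure LabelMatch (M : Act S → Act S → Prop) : Prop where
  refl : ∀ α, M α α
  onAct : ∀ (f : Subst S) α β, M α β → M (f.onAct α) (f.onAct β)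
  eq_or_op : ∀ α β, M α β → α = β ∨ ∃ X E F, α = .op X E ∧ β = .op X F

/-- The labels agree, except that operations may have a diamond distance up to `lam`. -/
def Near (lam : ℝ≥0) (α β : Act S) : Prop :=
  α = β ∨ ∃ X E F, α = .op X E ∧ β = .op X F ∧ diamondDist E F ≤ lam

theorem labelMatch_eq : LabelMatch (S := S) Eq :=
  ⟨fun _ => rfl, fun _ _ _ h => by rw [h], fun _ _ h => .inl h⟩

theorem labelMatch_near (lam : ℝ≥0) : LabelMatch (S := S) (Near lam) := by
  refine ⟨fun _ => .inl rfl, ?_, ?_⟩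
  · rintro f α β (rfl | ⟨X, E, F, rfl, rfl, h⟩)
    · exact .inl rfl
    · exact .inr ⟨_, _, _, rfl, rfl, (diamondDist_reindex_le _ E F).trans h⟩
  · rintro α β (rfl | ⟨X, E, F, rfl, rfl, -⟩)
    · exact .inl rfl
    · exact .inr ⟨X, E, F, rfl, rfl⟩

namespace LabelMatch
variable {M : Act S → Act S → Prop} (hM : LabelMatch M)
include hM

theorem eq_inp {c : S.Chan} {x : S.Var} {β : Act S} (h : M (.inp c x) β) : β = .inp c x := by
  rcases hM.eq_or_op _ _ h with h | ⟨_, _, _, ⟨⟩, _⟩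
  exact h.symm

theorem eq_out {c : S.Chan} {x : S.Var} {β : Act S} (h : M (.out c x) β) : β = .out c x := by
  rcases hM.eq_or_op _ _ h with h | ⟨_, _, _, ⟨⟩, _⟩
  exact h.symm

theorem eq_tau {β : Act S} (h : M .tau β) : β = .tau := by
  rcases hM.eq_or_op _ _ h with h | ⟨_, _, _, ⟨⟩, _⟩
  exact h.symm

theorem inp_eq {α : Act S} {c : S.Chan} {x : S.Var} (h : M α (.inp c x)) : α = .inp c x := by
  rcases hM.eq_or_op _ _ h with h | ⟨_, _, _, _, ⟨⟩⟩
  exact h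

theorem chanMem {α β : Act S} (h : M α β) {L : Set S.Chan} : β.ChanMem L → α.ChanMem L := by
  rcases hM.eq_or_op _ _ h with rfl | ⟨_, _, _, rfl, rfl⟩ <;> exact id

end LabelMatch

/-- If `α` is an input, then its variable is free in neither `P` nor `Q`. -/
def FreshFor (α : Act S) (P Q : Raw S) : Prop :=
  ∀ c x, α = .inp c x → x ∉ P.fv ∧ x ∉ Q.fv

theorem freshFor_of_not_isInput {α : Act S} (hα : ¬ α.IsInput) (P Q : Raw S) : FreshFor α P Q := by
  rintro c x rfl
  exact absurd trivial hα

section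
variable (Δ : Defn S) (M : Act S → Act S → Prop)

/-- Bisimulations of the system without states, for labels matched by `M`. -/
structure IsMBisim (R : Raw S → Raw S → Prop) : Prop where
  symm : ∀ P Q, R P Q → R Q P
  subst : ∀ P Q f, R P Q → R (P.subst f) (Q.subst f)
  step : ∀ P Q, R P Q → ∀ α P', Lts Δ P α P' → FreshFor α P Q →
    ∃ β Q', M α β ∧ Lts Δ Q β Q' ∧ R P' Q'

/-- Bisimilarity in the system without states, for labels matched by `M`. -/
def MBisim (P Q : Raw S) : Prop := ∃ R, IsMBisim Δ M R ∧ R P Q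

theorem isMBisim_mBisim : IsMBisim Δ M (MBisim Δ M) where
  symm := fun _ _ ⟨R, hR, h⟩ => ⟨R, hR, hR.symm _ _ h⟩
  subst := fun _ _ f ⟨R, hR, h⟩ => ⟨R, hR, hR.subst _ _ f h⟩
  step := fun _ _ ⟨R, hR, h⟩ α P' hs hf => by
    obtain ⟨β, Q', hβ, hQ, h'⟩ := hR.step _ _ h α P' hs hf
    exact ⟨β, Q', hβ, hQ, R, hR, h'⟩

variable {Δ M}

/-- Coinduction for `MBisim`. -/
theorem MBisim.coinduct (R : Raw S → Raw S → Prop) (symm : ∀ P Q, R P Q → R Q P)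
    (subst : ∀ P Q f, R P Q → R (P.subst f) (Q.subst f))
    (step : ∀ P Q, R P Q → ∀ α P', Lts Δ P α P' → FreshFor α P Q →
      ∃ β Q', M α β ∧ Lts Δ Q β Q' ∧ (R P' Q' ∨ MBisim Δ M P' Q')) {P Q : Raw S} (h : R P Q) :
    MBisim Δ M P Q := by
  have hb := isMBisim_mBisim Δ M
  refine ⟨fun P Q => R P Q ∨ MBisim Δ M P Q, ⟨?_, ?_, ?_⟩, .inl h⟩
  · exact fun P Q h => h.imp (symm P Q) (hb.symm P Q)
  · exact fun P Q f h => h.imp (subst P Q f) (hb.subst P Q f)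
  · rintro P Q (h | h) α P' hs hf
    · exact step P Q h α P' hs hf
    · obtain ⟨β, Q', hβ, hQ, h'⟩ := hb.step P Q h α P' hs hf
      exact ⟨β, Q', hβ, hQ, .inr h'⟩

theorem MBisim.symm {P Q : Raw S} (h : MBisim Δ M P Q) : MBisim Δ M Q P :=
  (isMBisim_mBisim Δ M).symm P Q h

theorem MBisim.subst {P Q : Raw S} (h : MBisim Δ M P Q) (f : Subst S) :
    MBisim Δ M (P.subst f) (Q.subst f) :=
  (isMBisim_mBisim Δ M).subst P Q f h

theorem MBisim.step {P Q : Raw S} (h : MBisim Δ M P Q) {α : Act S} {P' : Raw S}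
    (hs : Lts Δ P α P') (hf : FreshFor α P Q) :
    ∃ β Q', M α β ∧ Lts Δ Q β Q' ∧ MBisim Δ M P' Q' :=
  (isMBisim_mBisim Δ M).step P Q h α P' hs hf

namespace LabelMatch
variable (hM : LabelMatch M)
include hM

theorem mBisim_refl (P : Raw S) : MBisim Δ M P P :=
  ⟨Eq, ⟨fun _ _ h => h.symm, fun _ _ _ h => by rw [h], by
    rintro P _ rfl α P' hs -
    exact ⟨α, P', hM.refl α, hs, rfl⟩⟩, rfl⟩

/-- Equality up to bound variables is itself a bisimulation, by `Alpha.lts`. -/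
theorem mBisim_of_alpha {P Q : Raw S} (h : Alpha (.refl S) P Q) : MBisim Δ M P Q := by
  refine ⟨Alpha (.refl S), ⟨fun P Q h => h.symm, fun P Q f h => ?_, fun P Q h α P' hs _ => ?_⟩, h⟩
  · exact ((h.subst_right f).subst_left f).congr fun z _ => by simp
  · obtain ⟨Q', hQ, h'⟩ := h.lts hs
    rw [Subst.onAct_refl] at hQ
    exact ⟨α, Q', hM.refl α, hQ, h'⟩

/-- `Raw.subst` also renames bound variables, so the two terms may differ literally even though no
free variable moves. -/
theorem mBisim_subst_of_fix {P : Raw S} {f : Subst S} (hf : ∀ x ∈ P.fv, f.perm x = x) :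
    MBisim Δ M P (P.subst f) :=
  hM.mBisim_of_alpha ((Alpha.of_subst f P).congr hf)

/-- It is enough to match inputs of variables that need not be renamed later. -/
theorem mBisim_of_rel (R : Proc S → Proc S → Prop) (symm : ∀ P Q, R P Q → R Q P)
    (step : ∀ P Q, R P Q → ∀ α (P' : Proc S), ¬ α.IsInput → Lts Δ P.1 α P'.1 →
      ∃ β Q', M α β ∧ Lts Δ Q.1 β (Subtype.val Q') ∧ R P' Q')
    (input : ∀ P Q, R P Q → ∀ c x (P' : Proc S), Lts Δ P.1 (.inp c x) P'.1 →
      x ∉ P.fv ∪ Q.fv → ∃ Q', Lts Δ Q.1 (.inp c x) (Subtype.val Q') ∧ R P' Q')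
    {P Q : Proc S} (h : R P Q) : MBisim Δ M P.1 Q.1 := by
  -- The witness is the closure of `R` under renaming both sides alike. A move of a renamed term is
  -- pulled back along the inverse of `f`, answered there, and pushed forward again.
  refine ⟨fun A B => ∃ (P Q : Proc S) (f : Subst S), R P Q ∧ A = P.1.subst f ∧ B = Q.1.subst f,
    ⟨?_, ?_, ?_⟩, P, Q, .refl S, h, by simp, by simp⟩
  · rintro _ _ ⟨P, Q, f, h, rfl, rfl⟩
    exact ⟨Q, P, f, symm P Q h, rfl, rfl⟩
  · rintro _ _ g ⟨P, Q, f, h, rfl, rfl⟩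
    exact ⟨P, Q, f.trans g, h, Raw.subst_subst _ _ _, Raw.subst_subst _ _ _⟩
  · rintro _ _ ⟨P, Q, f, h, rfl, rfl⟩ α P'' hs hf
    have hs' := hs.subst f.symm
    rw [Raw.subst_subst, Subst.trans_symm, Raw.subst_refl] at hs'
    have hback : ∀ A : Raw S, (A.subst f.symm).subst f = A := fun A => by
      rw [Raw.subst_subst, Subst.symm_trans, Raw.subst_refl]
    have hact : ∀ α : Act S, f.onAct (f.symm.onAct α) = α := fun α => by
      rw [Subst.onAct_onAct, Subst.symm_trans, Subst.onAct_refl]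
    by_cases hα : α.IsInput
    · obtain ⟨c, x, rfl⟩ : ∃ c x, α = .inp c x := by
        cases α <;> first | exact hα.elim | exact ⟨_, _, rfl⟩
      have hx := hf c x rfl
      rw [Raw.fv_subst, Raw.fv_subst, Subst.mem_image, Subst.mem_image] at hx
      obtain ⟨Q', hQ, h'⟩ := input P Q h c (f.symm.perm x) ⟨_, hs'.wf P.2⟩ hs'
        (by simpa [Proc.fv] using hx)
      refine ⟨_, Q'.1.subst f, hM.refl _, ?_, _, Q', f, h', (hback _).symm, rfl⟩
      have := hQ.subst f
      simpa [Subst.onAct] using this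
    · obtain ⟨β, Q', hβ, hQ, h'⟩ := step P Q h _ ⟨_, hs'.wf P.2⟩ (by simpa using hα) hs'
      have := hM.onAct f _ _ hβ
      rw [hact] at this
      exact ⟨_, _, this, hQ.subst f, _, Q', f, h', (hback _).symm, rfl⟩

/-- The instances for all `y` come from the closure of `MBisim` under substitution. -/
theorem inputClause {P Q : Proc S} (h : MBisim Δ M P.1 Q.1) (ρ σ : State S) :
    InputClause Δ (fun C C' => MBisim Δ M C.1.1 C'.1.1) P ρ Q σ := by
  intro c x P' hs hx
  obtain ⟨β, Q', hβ, hQ, h'⟩ := h.step hs.lts.1 (by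
    rintro _ _ ⟨⟩
    simpa [Proc.fv] using hx)
  obtain rfl := hM.eq_inp hβ
  exact ⟨⟨Q', hQ.wf Q.2⟩, hQ.trans σ, fun y hy _ => h'.subst _⟩

/-! ### Congruence -/

/-- Both directions of matching are assumed since a bisimulation is symmetric, while `M` need not
be. -/
theorem mBisim_pre {α β : Act S} (hα : ¬ α.IsInput) (hβ : ¬ β.IsInput) (h₁ : M α β) (h₂ : M β α)
    {P Q : Raw S} (h : MBisim Δ M P Q) : MBisim Δ M (.pre α P) (.pre β Q) := by
  refine MBisim.coinduct (fun A B => ∃ α β P Q, ¬ Act.IsInput α ∧ ¬ Act.IsInput β ∧ M α β ∧ M β α ∧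
    MBisim Δ M P Q ∧ A = .pre α P ∧ B = .pre β Q) ?_ ?_ ?_ ⟨α, β, P, Q, hα, hβ, h₁, h₂, h, rfl, rfl⟩
  · rintro _ _ ⟨α, β, P, Q, hα, hβ, h₁, h₂, h, rfl, rfl⟩
    exact ⟨β, α, Q, P, hβ, hα, h₂, h₁, h.symm, rfl, rfl⟩
  · rintro _ _ f ⟨α, β, P, Q, hα, hβ, h₁, h₂, h, rfl, rfl⟩
    exact ⟨_, _, _, _, by simpa using hα, by simpa using hβ, hM.onAct f _ _ h₁, hM.onAct f _ _ h₂,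
      h.subst f, rfl, rfl⟩
  · rintro _ _ ⟨α, β, P, Q, hα, hβ, h₁, h₂, h, rfl, rfl⟩ γ P' hs hf
    cases hs with
    | act => exact ⟨β, Q, h₁, .act Q hβ, .inr h⟩
    | input => exact absurd trivial hα

theorem mBisim_inp (c : S.Chan) (x : S.Var) {P Q : Raw S} (h : MBisim Δ M P Q) :
    MBisim Δ M (.pre (.inp c x) P) (.pre (.inp c x) Q) := by
  refine MBisim.coinduct (fun A B => ∃ c x P Q, MBisim Δ M P Q ∧ A = .pre (.inp c x) P ∧
    B = .pre (.inp c x) Q) ?_ ?_ ?_ ⟨c, x, P, Q, h, rfl, rfl⟩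
  · rintro _ _ ⟨c, x, P, Q, h, rfl, rfl⟩
    exact ⟨c, x, Q, P, h.symm, rfl, rfl⟩
  · rintro _ _ f ⟨c, x, P, Q, h, rfl, rfl⟩
    exact ⟨_, _, _, _, h.subst f, rfl, rfl⟩
  · rintro _ _ ⟨c, x, P, Q, h, rfl, rfl⟩ γ P' hs hf
    cases hs with
    | act _ hα => exact absurd trivial hα
    | input _ _ y hy _ hyP =>
      exact ⟨_, _, hM.refl _, .input c x y hy Q (hf c y rfl).2, .inr (h.subst _)⟩

theorem mBisim_sum {P Q : Raw S} (R : Raw S) (h : MBisim Δ M P Q) :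
    MBisim Δ M (.sum P R) (.sum Q R) := by
  refine MBisim.coinduct (fun A B => ∃ P Q R, MBisim Δ M P Q ∧ A = .sum P R ∧ B = .sum Q R)
    ?_ ?_ ?_ ⟨P, Q, R, h, rfl, rfl⟩
  · rintro _ _ ⟨P, Q, R, h, rfl, rfl⟩
    exact ⟨Q, P, R, h.symm, rfl, rfl⟩
  · rintro _ _ f ⟨P, Q, R, h, rfl, rfl⟩
    exact ⟨_, _, _, h.subst f, rfl, rfl⟩
  · rintro _ _ ⟨P, Q, R, h, rfl, rfl⟩ α P' hs hf
    cases hs with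
    | choiceL _ hs =>
      obtain ⟨β, Q', hβ, hQ, h'⟩ := h.step hs fun c x hx => by
        have := hf c x hx
        simp only [Raw.fv, Finset.mem_union, not_or] at this
        exact ⟨this.1.1, this.2.1⟩
      exact ⟨β, Q', hβ, .choiceL R hQ, .inr h'⟩
    | choiceR _ hs => exact ⟨α, P', hM.refl α, .choiceR Q hs, .inr (hM.mBisim_refl P')⟩

theorem mBisim_restr {P Q : Raw S} (L : Set S.Chan) (h : MBisim Δ M P Q) :
    MBisim Δ M (.restr P L) (.restr Q L) := by
  refine MBisim.coinduct (fun A B => ∃ P Q, MBisim Δ M P Q ∧ A = .restr P L ∧ B = .restr Q L)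
    ?_ ?_ ?_ ⟨P, Q, h, rfl, rfl⟩
  · rintro _ _ ⟨P, Q, h, rfl, rfl⟩
    exact ⟨Q, P, h.symm, rfl, rfl⟩
  · rintro _ _ f ⟨P, Q, h, rfl, rfl⟩
    exact ⟨_, _, h.subst f, rfl, rfl⟩
  · rintro _ _ ⟨P, Q, h, rfl, rfl⟩ α P' hs hf
    cases hs with
    | restr hs hα =>
      obtain ⟨β, Q', hβ, hQ, h'⟩ := h.step hs hf
      exact ⟨β, _, hβ, .restr hQ (mt (hM.chanMem hβ) hα), .inl ⟨_, _, h', rfl, rfl⟩⟩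

/-- Well-formedness is kept inside the relation because the communication case depends on
disjointness of free variables. -/
theorem mBisim_par {P Q R : Raw S} (hP : (Raw.par P R).WF) (hQ : (Raw.par Q R).WF)
    (h : MBisim Δ M P Q) : MBisim Δ M (.par P R) (.par Q R) := by
  refine MBisim.coinduct (fun A B => ∃ P Q R, MBisim Δ M P Q ∧ A = .par P R ∧ B = .par Q R ∧
    A.WF ∧ B.WF) ?_ ?_ ?_ ⟨P, Q, R, h, rfl, rfl, hP, hQ⟩
  · rintro _ _ ⟨P, Q, R, h, rfl, rfl, hP, hQ⟩
    exact ⟨Q, P, R, h.symm, rfl, rfl, hQ, hP⟩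
  · rintro _ _ f ⟨P, Q, R, h, rfl, rfl, hP, hQ⟩
    exact ⟨_, _, _, h.subst f, rfl, rfl, hP.subst f, hQ.subst f⟩
  · rintro _ _ ⟨P, Q, R, h, rfl, rfl, hP, hQ⟩ α P' hs hf
    suffices ∃ β P₁ Q₁ R₁, P' = .par P₁ R₁ ∧ M α β ∧ Lts Δ (.par Q R) β (.par Q₁ R₁) ∧
        MBisim Δ M P₁ Q₁ by
      obtain ⟨β, P₁, Q₁, R₁, rfl, hβ, hs', h'⟩ := this
      exact ⟨β, _, hβ, hs', .inl ⟨P₁, Q₁, R₁, h', rfl, rfl, hs.wf hP, hs'.wf hQ⟩⟩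
    have hf' : ∀ c x, α = .inp c x → (x ∉ P.fv ∧ x ∉ R.fv) ∧ x ∉ Q.fv := fun c x hx => by
      have := hf c x hx
      simp only [Raw.fv, Finset.mem_union, not_or] at this
      exact ⟨this.1, this.2.1⟩
    cases hs with
    | intlL hs hα =>
      obtain ⟨β, Q', hβ, hQ', h'⟩ := h.step hs fun c x hx => ⟨(hf' c x hx).1.1, (hf' c x hx).2⟩
      refine ⟨β, _, Q', R, rfl, hβ, .intlL hQ' ?_, h'⟩
      rintro c x rfl
      exact hα c x (hM.inp_eq hβ)
    | intlR hs hα =>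
      exact ⟨α, _, _, _, rfl, hM.refl α, .intlR hs fun c x hx => (hf' c x hx).2, h⟩
    | commL hs₁ hs₂ =>
      -- The variable sent by `R` is free in `R`, hence in neither `P` nor `Q`, so the restricted
      -- input clause does apply.
      have hx := hs₂.mem_fv_out
      obtain ⟨β, Q', hβ, hQ', h'⟩ := h.step hs₁ (by
        rintro _ _ ⟨⟩
        exact ⟨Finset.disjoint_right.1 hP.2.2 hx, Finset.disjoint_right.1 hQ.2.2 hx⟩)
      obtain rfl := hM.eq_inp hβ
      exact ⟨_, _, _, _, rfl, hM.refl _, .commL hQ' hs₂, h'⟩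
    | commR hs₁ hs₂ =>
      obtain ⟨β, Q', hβ, hQ', h'⟩ := h.step hs₁ (freshFor_of_not_isInput id _ _)
      obtain rfl := hM.eq_out hβ
      exact ⟨_, _, _, _, rfl, hM.refl _, .commR hQ' hs₂, h'⟩

end LabelMatch

/-! ### Comparison with the bisimilarities on configurations -/

/-- One state, here the zero operator, suffices to extract a bisimulation from a statement about all
states. -/
noncomputable instance : Inhabited (State S) :=
  ⟨0, ContinuousLinearMap.isPositive_zero, by simp [opTrace]⟩

/-- States are forgotten in one direction, and in the other the relation on configurations ignores
them altogether. -/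
theorem bisim_iff {P Q : Proc S} : Bisim Δ P Q ↔ MBisim Δ Eq P.1 Q.1 := by
  constructor
  · intro h
    obtain ⟨R, hR, h⟩ := h default
    refine labelMatch_eq.mBisim_of_rel (fun P Q => ∃ ρ σ, R (P, ρ) (Q, σ)) ?_ ?_ ?_ ⟨_, _, h⟩
    · rintro P Q ⟨ρ, σ, h⟩
      exact ⟨σ, ρ, hR.1 _ _ h⟩
    · rintro P Q ⟨ρ, σ, h⟩ α P' hα hs
      obtain ⟨Q', σ', hQ, h'⟩ := (hR.2 P ρ Q σ h).1 α P' _ hα (hs.trans ρ)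
      exact ⟨α, Q', rfl, hQ.lts.1, _, _, h'⟩
    · rintro P Q ⟨ρ, σ, h⟩ c x P' hs hx
      obtain ⟨Q', hQ, h'⟩ := (hR.2 P ρ Q σ h).2 c x P' (hs.trans ρ) hx
      -- The instance `y = x` of the input clause suffices, as the substitution is then the
      -- identity.
      have := h' x rfl (by simp)
      simp only [Subst.swap_self, Proc.subst_refl] at this
      exact ⟨Q', hQ.lts.1, ρ, σ, this⟩
  · intro h ρ
    refine ⟨fun C C' => MBisim Δ Eq C.1.1 C'.1.1, ⟨fun _ _ h => h.symm, fun P ρ Q σ h => ⟨?_, ?_⟩⟩, h⟩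
    · intro α P' ρ' hα hs
      obtain ⟨_, Q', rfl, hQ, h'⟩ := h.step hs.lts.1 (freshFor_of_not_isInput hα _ _)
      exact ⟨⟨Q', hQ.wf Q.2⟩, _, hQ.trans σ, h'⟩
    · exact labelMatch_eq.inputClause h ρ σ

/-- As for `bisim_iff`. The pairs with equal processes and nearby states are present by reflexivity,
since the constructed relation ignores states. -/
theorem approxBisim_iff {lam : ℝ≥0} {P Q : Proc S} :
    ApproxBisim Δ lam P Q ↔ MBisim Δ (Near lam) P.1 Q.1 := by
  have hM := labelMatch_near (S := S) lam
  constructor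
  · intro h
    obtain ⟨R, hR, h⟩ := h default
    refine hM.mBisim_of_rel (fun P Q => ∃ ρ σ, R (P, ρ) (Q, σ)) ?_ ?_ ?_ ⟨_, _, h⟩
    · rintro P Q ⟨ρ, σ, h⟩
      exact ⟨σ, ρ, hR.1 _ _ h⟩
    · rintro P Q ⟨ρ, σ, h⟩ α P' hα hs
      obtain ⟨h₁, h₂, -⟩ := hR.2.2 P ρ Q σ h
      cases α with
      | tau =>
        obtain ⟨Q', hQ, h'⟩ := h₁ _ P' (.inl rfl) (hs.trans ρ)
        exact ⟨_, Q', .inl rfl, hQ.lts.1, _, _, h'⟩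
      | out c x =>
        obtain ⟨Q', hQ, h'⟩ := h₁ _ P' (.inr ⟨c, x, rfl⟩) (hs.trans ρ)
        exact ⟨_, Q', .inl rfl, hQ.lts.1, _, _, h'⟩
      | inp c x => exact absurd trivial hα
      | op X E =>
        obtain ⟨F, Q', σ', hQ, h', hd⟩ := h₂ X E P' _ (hs.trans ρ)
        exact ⟨_, Q', .inr ⟨X, E, F, rfl, rfl, hd⟩, hQ.lts.1, _, _, h'⟩
    · rintro P Q ⟨ρ, σ, h⟩ c x P' hs hx
      obtain ⟨Q', hQ, h'⟩ := (hR.2.2 P ρ Q σ h).2.2 c x P' (hs.trans ρ) hx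
      have := h' x rfl (by simp)
      simp only [Subst.swap_self, Proc.subst_refl] at this
      exact ⟨Q', hQ.lts.1, ρ, σ, this⟩
  · intro h ρ
    refine ⟨fun C C' => MBisim Δ (Near lam) C.1.1 C'.1.1, ⟨fun _ _ h => h.symm,
      fun P _ _ _ => hM.mBisim_refl P.1, fun P ρ Q σ h => ⟨?_, ?_, ?_⟩⟩, h⟩
    · rintro α P' hα hs
      have hα' : ¬ α.IsInput := by
        rcases hα with rfl | ⟨c, x, rfl⟩ <;> exact id
      obtain ⟨β, Q', hβ, hQ, h'⟩ := h.step hs.lts.1 (freshFor_of_not_isInput hα' _ _)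
      refine ⟨⟨Q', hQ.wf Q.2⟩, ?_, h'⟩
      rcases hα with rfl | ⟨c, x, rfl⟩
      · obtain rfl := hM.eq_tau hβ
        exact hQ.trans σ
      · obtain rfl := hM.eq_out hβ
        exact hQ.trans σ
    · intro X E P' ρ' hs
      obtain ⟨β, Q', hβ, hQ, h'⟩ := h.step hs.lts.1 (freshFor_of_not_isInput id _ _)
      obtain ⟨F, rfl, hd⟩ : ∃ F, β = .op X F ∧ diamondDist E F ≤ lam := by
        rcases hβ with rfl | ⟨_, _, F, ⟨⟩, rfl, hd⟩
        · exact ⟨E, rfl, by simp [diamondDist_self]⟩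
        · exact ⟨F, rfl, hd⟩
      exact ⟨F, ⟨Q', hQ.wf Q.2⟩, _, hQ.trans σ, h', hd⟩
    · exact hM.inputClause h ρ σ

end

/-! ### Operation reduction under substitutions -/

/-- Renaming in a string of operations. -/
noncomputable def Subst.onOps (f : Subst S) (l : List (Σ X : Finset S.Var, SuperOp (Idx S X))) :
    List (Σ X : Finset S.Var, SuperOp (Idx S X)) :=
  l.map fun p => ⟨f.image p.1, p.2.reindex (f.idxEquiv p.1)⟩

theorem Subst.image_union (f : Subst S) (X Y : Finset S.Var) :
    f.image (X ∪ Y) = f.image X ∪ f.image Y :=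
  Finset.map_union _ _

theorem opSupport_onOps (f : Subst S) (l : List (Σ X : Finset S.Var, SuperOp (Idx S X))) :
    opSupport (f.onOps l) = f.image (opSupport l) := by
  induction l with
  | nil => rfl
  | cons p l ih =>
    change f.image p.1 ∪ opSupport (f.onOps l) = f.image (p.1 ∪ opSupport l)
    rw [ih, Subst.image_union]

/-- Renaming variables commutes with reading and with overwriting the `Y`-components of a basis
index, hence with tensoring by the identity. -/
theorem SuperOp.reindex_extend (f : Subst S) {X Y : Finset S.Var} (h : Y ⊆ X)
    (h' : f.image Y ⊆ f.image X) (E : SuperOp (Idx S Y)) :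
    (E.reindex (f.idxEquiv Y)).extend (subLens S h') =
      (E.extend (subLens S h)).reindex (f.idxEquiv X) := by
  have hupd : ∀ i k, f.idxEquiv X ((subLens S h).upd ((f.idxEquiv X).symm i) k) =
      (subLens S h').upd i (f.idxEquiv Y k) := fun i k => by
    obtain ⟨i, rfl⟩ := (f.idxEquiv X).surjective i
    rw [Equiv.symm_apply_apply]
    funext ⟨x, hx⟩
    apply Fin.ext
    by_cases hy : f.symm.perm x ∈ Y
    · have hy' : f.perm.symm x ∈ Y := hy
      simp [subLens, Subst.idxEquiv, hy, hy']
    · have hy' : f.perm.symm x ∉ Y := hy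
      simp [subLens, Subst.idxEquiv, hy, hy']
  have hres : ∀ i, (subLens S h).res ((f.idxEquiv X).symm i) =
      (f.idxEquiv Y).symm ((subLens S h').res i) := fun i => rfl
  refine SuperOp.ext_toLin (LinearMap.ext fun A => ?_)
  ext i j
  simp [SuperOp.extend, SuperOp.reindex, Matrix.reindexLinearEquiv, hres, Matrix.submatrix, hupd]

theorem opComp_onOps (f : Subst S) (X : Finset S.Var)
    (l : List (Σ X : Finset S.Var, SuperOp (Idx S X))) (h : opSupport l ⊆ X)
    (h' : opSupport (f.onOps l) ⊆ f.image X) :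
    opComp (f.image X) (f.onOps l) h' = (opComp X l h).reindex (f.idxEquiv X) := by
  induction l with
  | nil =>
    refine SuperOp.ext_toLin (LinearMap.ext fun A => ?_)
    simp [Subst.onOps, opComp, SuperOp.reindex, SuperOp.id]
  | cons p l ih =>
    have hp : f.image p.1 ⊆ f.image X := Finset.union_subset_left h'
    have hl : opSupport (f.onOps l) ⊆ f.image X := Finset.union_subset_right h'
    change (opComp (f.image X) (f.onOps l) hl).comp
      ((p.2.reindex (f.idxEquiv p.1)).extend (subLens S hp)) = _
    rw [ih (Finset.union_subset_right h),
      SuperOp.reindex_extend f (Finset.union_subset_left h)]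
    refine SuperOp.ext_toLin (LinearMap.ext fun A => ?_)
    simp [opComp, SuperOp.comp, SuperOp.reindex, Matrix.reindexLinearEquiv]

theorem StrRed.subst {s t : List (Act S)} (h : StrRed s t) (f : Subst S) :
    StrRed (s.map f.onAct) (t.map f.onAct) := by
  induction h with
  | oper l hl =>
    -- The super-operator's type depends on the support, so the support equation is generalised
    -- before it is used for rewriting.
    have key : ∀ X (hX : opSupport (f.onOps l) = X),
        Act.op (opSupport (f.onOps l)) (opComp _ (f.onOps l) (Finset.Subset.refl _)) =
          Act.op X (opComp X (f.onOps l) hX.subset) := by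
      rintro _ rfl
      rfl
    have h := StrRed.oper (f.onOps l) (by simpa [Subst.onOps] using hl)
    rw [key _ (opSupport_onOps f l), opComp_onOps f _ l (Finset.Subset.refl _)] at h
    simpa [Subst.onOps, Subst.onAct, Function.comp_def] using h
  | struct t₁ t₂ h ih =>
    simp only [List.map_append]
    exact .struct _ _ ih

theorem Raw.subst_pres (f : Subst S) (t : List (Act S)) (P : Raw S) :
    (Raw.pres t P).subst f = .pres (t.map f.onAct) (P.subst f) := by
  induction t with
  | nil => rfl
  | cons α t ih => exact congrArg (Raw.pre (f.onAct α)) ih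

theorem Red.subst {P Q : Raw S} (h : Red P Q) (f : Subst S) : Red (P.subst f) (Q.subst f) := by
  induction h with
  | act P h =>
    rw [Raw.subst_pres, Raw.subst_pres]
    exact .act _ (h.subst f)
  | pre α h ih => exact .pre _ ih
  | sumL Q h ih => exact .sumL _ ih
  | sumR P h ih => exact .sumR _ ih
  | parL Q h ih => exact .parL _ ih
  | parR P h ih => exact .parR _ ih
  | restr L h ih => exact .restr L ih
  | refl P => exact .refl _
  | trans h₁ h₂ ih₁ ih₂ => exact .trans ih₁ ih₂

/-! ### Chains -/

variable {Δ : Defn S}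

theorem Bisim.refl (P : Proc S) : Bisim Δ P P := bisim_iff.2 (labelMatch_eq.mBisim_refl P.1)

theorem Bisim.redEq {P Q : Proc S} (h : Bisim Δ P Q) : RedEq Δ P Q :=
  ⟨P, P, Q, Q, .refl P, .refl _, .refl Q, .refl _, h⟩

theorem Bisim.redBisim {P Q : Proc S} (h : Bisim Δ P Q) : RedBisim Δ P Q := .single h.redEq

theorem RedBisim.refl (P : Proc S) : RedBisim Δ P P := (Bisim.refl P).redBisim

theorem RedEq.symm {P Q : Proc S} : RedEq Δ P Q → RedEq Δ Q P :=
  fun ⟨P₁, P₂, Q₁, Q₂, hP, hP', hQ, hQ', h⟩ =>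
    ⟨Q₁, Q₂, P₁, P₂, hQ, hQ', hP, hP', bisim_iff.2 (bisim_iff.1 h).symm⟩

theorem RedBisim.symm {P Q : Proc S} (h : RedBisim Δ P Q) : RedBisim Δ Q P := by
  induction h with
  | single h => exact .single h.symm
  | tail h₁ h₂ ih => exact .head h₂.symm ih

theorem ApproxBisim.symm {lam : ℝ≥0} {P Q : Proc S} (h : ApproxBisim Δ lam P Q) :
    ApproxBisim Δ lam Q P :=
  approxBisim_iff.2 (approxBisim_iff.1 h).symm

/-! ### Concatenation and reversal of chains, and the pseudo-metric laws -/

namespace RedChain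

theorem head {s : ℝ≥0} {P Q R : Proc S} (h₁ : RedBisim Δ P Q) (h₂ : RedChain Δ s Q R) :
    RedChain Δ s P R := by
  cases h₂ with
  | last h => exact .last (h₁.trans h)
  | step h h' h'' => exact .step (h₁.trans h) h' h''

theorem trans {s t : ℝ≥0} {P Q R : Proc S} (h₁ : RedChain Δ s P Q) (h₂ : RedChain Δ t Q R) :
    RedChain Δ (s + t) P R := by
  induction h₁ with
  | last h => rw [zero_add]; exact h₂.head h
  | step h h' h'' ih => rw [add_assoc]; exact .step h h' (ih h₂)

theorem of_approxBisim {lam : ℝ≥0} {P Q : Proc S} (h : ApproxBisim Δ lam P Q) :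
    RedChain Δ lam P Q := by
  simpa using RedChain.step (.refl P) h (.last (.refl Q))

theorem symm {s : ℝ≥0} {P Q : Proc S} (h : RedChain Δ s P Q) : RedChain Δ s Q P := by
  induction h with
  | last h => exact .last h.symm
  | step h h' h'' ih =>
    rw [add_comm]
    exact ih.trans (by simpa using (of_approxBisim h'.symm).trans (.last h.symm))

end RedChain

/-- The slack `s ≤ lam` does not affect the infimum, so exact chain weights can be used throughout.
-/
theorem dsrb_eq (P Q : Proc S) :
    Dsrb Δ P Q = ⨅ (s : ℝ≥0) (_ : RedChain Δ s P Q), (s : ℝ≥0∞) :=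
  le_antisymm (le_iInf₂ fun s hs => iInf₂_le_of_le s ⟨s, le_rfl, hs⟩ le_rfl)
    (le_iInf₂ fun _ ⟨s, hs, h⟩ => iInf₂_le_of_le s h (by exact_mod_cast hs))

theorem dsrb_le {P Q : Proc S} {s : ℝ≥0} (h : RedChain Δ s P Q) : Dsrb Δ P Q ≤ s := by
  rw [dsrb_eq]
  exact iInf₂_le s h

theorem dsrb_mono {P Q P' Q' : Proc S} (h : ∀ s, RedChain Δ s P Q → RedChain Δ s P' Q') :
    Dsrb Δ P' Q' ≤ Dsrb Δ P Q := by
  rw [dsrb_eq P Q]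
  exact le_iInf₂ fun s hs => dsrb_le (h s hs)

theorem dsrb_self (P : Proc S) : Dsrb Δ P P = 0 :=
  nonpos_iff_eq_zero.1 (dsrb_le (.last (.refl P)))

theorem dsrb_comm (P Q : Proc S) : Dsrb Δ P Q = Dsrb Δ Q P :=
  le_antisymm (dsrb_mono fun _ h => h.symm) (dsrb_mono fun _ h => h.symm)

theorem dsrb_triangle (P Q R : Proc S) : Dsrb Δ P R ≤ Dsrb Δ P Q + Dsrb Δ Q R := by
  rw [dsrb_eq P Q, dsrb_eq Q R]
  simp only [ENNReal.iInf_add, ENNReal.add_iInf]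
  refine le_iInf fun s => le_iInf fun hs => le_iInf fun t => le_iInf fun ht => ?_
  exact_mod_cast dsrb_le (ht.trans hs)

/-! ### Contexts -/

/-- A substitution that moves the variables in `W` out of `V`, and fixes those that are not in `V`
already. -/
theorem exists_subst_avoiding (V W : Finset S.Var) :
    ∃ f : Subst S, ∀ w ∈ W, f.perm w ∉ V ∧ (w ∉ V → f.perm w = w) := by
  induction V using Finset.induction_on with
  | empty => exact ⟨.refl S, by simp⟩
  | insert v V hv ih =>
    obtain ⟨f, hf⟩ := ih
    -- The new variable `u` has the type of `v`. Lying outside the enlarged `V` makes it an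
    -- admissible image, and lying outside `f(W)` ensures that exchanging it with `v` affects only
    -- the element of `W` now sent to `v`.
    obtain ⟨u, hu, hu'⟩ := (S.infinite_type v).exists_notMem_finset (insert v V ∪ W ∪ f.image W)
    simp only [Finset.mem_union, not_or] at hu'
    refine ⟨f.trans (.swap v u hu), fun w hw => ?_⟩
    have hfw : f.perm w ≠ u := fun h => hu'.2 (by simpa [← h] using hw)
    have hwu : w ≠ u := fun h => hu'.1.2 (h ▸ hw)
    change Equiv.swap v u (f.perm w) ∉ _ ∧ (_ → Equiv.swap v u (f.perm w) = w)
    by_cases hwv : f.perm w = v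
    · rw [hwv, Equiv.swap_apply_left]
      refine ⟨hu'.1.1, fun h => ?_⟩
      simp only [Finset.mem_insert, not_or] at h
      exact absurd (((hf w hw).2 h.2).symm.trans hwv) h.1
    · rw [Equiv.swap_apply_of_ne_of_ne hwv hfw]
      simp only [Finset.mem_insert, not_or]
      exact ⟨⟨hwv, (hf w hw).1⟩, fun h => (hf w hw).2 h.2⟩

/-- A context whose hole takes the processes without free variables in `V`, and which respects
operation reduction and the bisimilarities. -/
structure Context (Δ : Defn S) (V : Finset S.Var) where
  fill : ∀ P : Proc S, Disjoint P.fv V → Proc S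
  mBisim : ∀ {M}, LabelMatch M → ∀ P Q hP hQ, MBisim Δ M P.1 Q.1 →
    MBisim Δ M (fill P hP).1 (fill Q hQ).1
  red : ∀ P Q hP hQ, Red P.1 Q.1 → Red (fill P hP).1 (fill Q hQ).1

namespace Context
variable {V : Finset S.Var} (C : Context Δ V)

theorem disjoint_fv {W : Finset S.Var} {f : Subst S} (hf : Disjoint (f.image W) V) {P : Proc S}
    (hP : P.fv ⊆ W) : Disjoint (P.subst f).fv V := by
  rw [Proc.fv_subst]
  exact hf.mono_left (Finset.map_subset_map.2 hP)

/-- The set `W` collects the free variables of all the processes involved, including the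
intermediate ones, so that any `f` moving `W` out of `V` makes every filling legitimate at once. -/
theorem redEq {P Q : Proc S} (h : RedEq Δ P Q) : ∃ W, P.fv ⊆ W ∧ Q.fv ⊆ W ∧
    ∀ f : Subst S, Disjoint (f.image W) V → ∀ hP hQ,
      RedEq Δ (C.fill (P.subst f) hP) (C.fill (Q.subst f) hQ) := by
  obtain ⟨P₁, P₂, Q₁, Q₂, hP, hP', hQ, hQ', h⟩ := h
  refine ⟨P.fv ∪ Q.fv ∪ (P₁.fv ∪ P₂.fv ∪ (Q₁.fv ∪ Q₂.fv)), by grind, by grind,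
    fun f hf dP dQ => ?_⟩
  have d : ∀ {A : Proc S}, A.fv ⊆ _ → Disjoint (A.subst f).fv V := disjoint_fv hf
  have hB : ∀ {A B : Proc S} dA dB, Bisim Δ A B →
      Bisim Δ (C.fill (A.subst f) dA) (C.fill (B.subst f) dB) := fun dA dB h =>
    bisim_iff.2 (C.mBisim labelMatch_eq _ _ dA dB ((bisim_iff.1 h).subst f))
  exact ⟨C.fill (P₁.subst f) (d (by grind)), C.fill (P₂.subst f) (d (by grind)),
    C.fill (Q₁.subst f) (d (by grind)), C.fill (Q₂.subst f) (d (by grind)), hB _ _ hP,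
    C.red _ _ _ _ (hP'.subst f), hB _ _ hQ, C.red _ _ _ _ (hQ'.subst f), hB _ _ h⟩

theorem redBisim {P Q : Proc S} (h : RedBisim Δ P Q) : ∃ W, P.fv ⊆ W ∧ Q.fv ⊆ W ∧
    ∀ f : Subst S, Disjoint (f.image W) V → ∀ hP hQ,
      RedBisim Δ (C.fill (P.subst f) hP) (C.fill (Q.subst f) hQ) := by
  induction h with
  | single h =>
    obtain ⟨W, h₁, h₂, h⟩ := C.redEq h
    exact ⟨W, h₁, h₂, fun f hf hP hQ => .single (h f hf hP hQ)⟩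
  | tail _ h ih =>
    obtain ⟨W, h₁, h₂, h⟩ := C.redEq h
    obtain ⟨W', h₁', h₂', h'⟩ := ih
    refine ⟨W' ∪ W, by grind, by grind, fun f hf hP hQ => ?_⟩
    rw [Subst.image_union, Finset.disjoint_union_left] at hf
    have hd := disjoint_fv hf.2 h₁
    exact .tail (h' f hf.1 hP hd) (h f hf.2 hd hQ)

theorem redChain_subst {s : ℝ≥0} {P Q : Proc S} (h : RedChain Δ s P Q) :
    ∃ W, P.fv ⊆ W ∧ Q.fv ⊆ W ∧ ∀ f : Subst S, Disjoint (f.image W) V → ∀ hP hQ,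
      RedChain Δ s (C.fill (P.subst f) hP) (C.fill (Q.subst f) hQ) := by
  induction h with
  | last h =>
    obtain ⟨W, h₁, h₂, h⟩ := C.redBisim h
    exact ⟨W, h₁, h₂, fun f hf hP hQ => .last (h f hf hP hQ)⟩
  | @step P R R' Q lam s hr ha _ ih =>
    obtain ⟨W, h₁, h₂, h⟩ := C.redBisim hr
    obtain ⟨W', h₁', h₂', h'⟩ := ih
    refine ⟨W ∪ W', by grind, by grind, fun f hf hP hQ => ?_⟩
    rw [Subst.image_union, Finset.disjoint_union_left] at hf
    have hR := disjoint_fv hf.1 h₂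
    have hR' := disjoint_fv hf.2 h₁'
    exact .step (h f hf.1 hP hR) (approxBisim_iff.2 (C.mBisim (labelMatch_near lam) _ _ hR hR'
      ((approxBisim_iff.1 ha).subst f))) (h' f hf.2 hR' hQ)

/-- The renamed chain lies wholly within the domain of the context, and its two ends are joined to
the original fillings by strong bisimilarities, which cost nothing. -/
theorem redChain {s : ℝ≥0} {P Q : Proc S} (h : RedChain Δ s P Q) (hP : Disjoint P.fv V)
    (hQ : Disjoint Q.fv V) : RedChain Δ s (C.fill P hP) (C.fill Q hQ) := by
  obtain ⟨W, hPW, hQW, hW⟩ := C.redChain_subst h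
  obtain ⟨f, hf⟩ := exists_subst_avoiding V W
  have hd : Disjoint (f.image W) V := by
    refine Finset.disjoint_left.2 fun x hx => ?_
    obtain ⟨w, hw, rfl⟩ := Finset.mem_map.1 hx
    exact (hf w hw).1
  have hB : ∀ (A : Proc S) (hAW : A.fv ⊆ W) (hA : Disjoint A.fv V),
      RedBisim Δ (C.fill A hA) (C.fill (A.subst f) (disjoint_fv hd hAW)) := fun A hAW hA =>
    (bisim_iff.2 (C.mBisim labelMatch_eq _ _ _ _ (labelMatch_eq.mBisim_subst_of_fix fun x hx =>
      (hf x (hAW hx)).2 (Finset.disjoint_left.1 hA hx)))).redBisim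
  have h' := (hW f hd (disjoint_fv hd hPW) (disjoint_fv hd hQW)).trans (.last (hB Q hQW hQ).symm)
  rw [add_zero] at h'
  exact h'.head (hB P hPW hP)

theorem dsrb_fill_le (P Q : Proc S) (hP : Disjoint P.fv V) (hQ : Disjoint Q.fv V) :
    Dsrb Δ (C.fill P hP) (C.fill Q hQ) ≤ Dsrb Δ P Q :=
  dsrb_mono fun _ h => C.redChain h hP hQ

/-- `τ.[·]` -/
def tau (Δ : Defn S) : Context Δ ∅ where
  fill P _ := P.tau
  mBisim hM _ _ _ _ h := hM.mBisim_pre id id (hM.refl _) (hM.refl _) h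
  red _ _ _ _ h := .pre _ h

/-- `E[X].[·]` -/
def op (Δ : Defn S) (X : Finset S.Var) (E : SuperOp (Idx S X)) : Context Δ ∅ where
  fill P _ := P.op X E
  mBisim hM _ _ _ _ h := hM.mBisim_pre id id (hM.refl _) (hM.refl _) h
  red _ _ _ _ h := .pre _ h

/-- `c!x.[·]` -/
def out (Δ : Defn S) (c : S.Chan) (x : S.Var) : Context Δ {x} where
  fill P h := P.out c x (Finset.disjoint_singleton_right.1 h)
  mBisim hM _ _ _ _ h := hM.mBisim_pre id id (hM.refl _) (hM.refl _) h
  red _ _ _ _ h := .pre _ h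

/-- `c?x.[·]` -/
def inp (Δ : Defn S) (c : S.Chan) (x : S.Var) : Context Δ ∅ where
  fill P _ := P.inp c x
  mBisim hM _ _ _ _ h := hM.mBisim_inp c x h
  red _ _ _ _ h := .pre _ h

/-- `[·] + R` -/
def sum (Δ : Defn S) (R : Proc S) : Context Δ ∅ where
  fill P _ := P.sum R
  mBisim hM _ _ _ _ h := hM.mBisim_sum R.1 h
  red _ _ _ _ h := .sumL _ h

/-- `[·] ‖ R` -/
def par (Δ : Defn S) (R : Proc S) : Context Δ R.fv where
  fill P h := P.par R h
  mBisim hM P Q hP hQ h := hM.mBisim_par (P.par R hP).2 (Q.par R hQ).2 h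
  red _ _ _ _ h := .parL _ h

/-- `[·] \ L` -/
def restr (Δ : Defn S) (L : Set S.Chan) : Context Δ ∅ where
  fill P _ := P.restr L
  mBisim hM _ _ _ _ h := hM.mBisim_restr L h
  red _ _ _ _ h := .restr _ h

end Context

/-! ### Operation prefixes with different super-operators -/

theorem approxBisim_op {X : Finset S.Var} {E F : SuperOp (Idx S X)} {lam : ℝ≥0}
    (h : diamondDist E F ≤ lam) (P : Proc S) : ApproxBisim Δ lam (P.op X E) (P.op X F) :=
  approxBisim_iff.2 ((labelMatch_near lam).mBisim_pre id id (.inr ⟨X, E, F, rfl, rfl, h⟩)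
    (.inr ⟨X, F, E, rfl, rfl, diamondDist_comm E F ▸ h⟩) ((labelMatch_near lam).mBisim_refl P.1))

theorem dsrb_op_le (P Q : Proc S) (X Y : Finset S.Var) (E : SuperOp (Idx S X))
    (F : SuperOp (Idx S Y)) :
    Dsrb Δ (P.op X E) (Q.op Y F) ≤ max (eta X Y) (opDist E F + Dsrb Δ P Q) := by
  by_cases hXY : X = Y
  · subst hXY
    refine le_max_of_le_right ?_
    rw [opDist, dif_pos rfl]
    -- A step of a chain carries a finite weight; with an infinite distance the bound is trivial.
    rcases eq_or_ne (diamondDist E F) ⊤ with hd | hd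
    · simp [hd]
    -- The intermediate process is `F[X].P`: a single approximate step of weight `diamondDist E F`
    -- reaches it, and the context `F[X].[·]` does the rest.
    calc Dsrb Δ (P.op X E) (Q.op X F)
        ≤ Dsrb Δ (P.op X E) (P.op X F) + Dsrb Δ (P.op X F) (Q.op X F) := dsrb_triangle _ _ _
      _ ≤ diamondDist E F + Dsrb Δ P Q := by
        refine add_le_add ?_ ((Context.op Δ X F).dsrb_fill_le P Q (by simp) (by simp))
        rw [← ENNReal.coe_toNNReal hd]
        exact dsrb_le (.of_approxBisim (approxBisim_op (ENNReal.coe_toNNReal hd).ge P))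
  · exact le_max_of_le_left (by simp [eta, hXY])

end QCCS

theorem theorem6p2 {S : QCCS.Sig.{u, v}} (Δ : QCCS.Defn S) :
    ((∀ P : QCCS.Proc S, QCCS.Dsrb Δ P P = 0) ∧
      (∀ P Q : QCCS.Proc S, QCCS.Dsrb Δ P Q = QCCS.Dsrb Δ Q P) ∧
      (∀ P Q R : QCCS.Proc S, QCCS.Dsrb Δ P R ≤ QCCS.Dsrb Δ P Q + QCCS.Dsrb Δ Q R)) ∧
    (∀ P Q : QCCS.Proc S,
      QCCS.Dsrb Δ P.tau Q.tau ≤ QCCS.Dsrb Δ P Q ∧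
      (∀ (c : S.Chan) (x : S.Var) (hP : x ∉ P.fv) (hQ : x ∉ Q.fv),
        QCCS.Dsrb Δ (P.out c x hP) (Q.out c x hQ) ≤ QCCS.Dsrb Δ P Q) ∧
      (∀ (c : S.Chan) (x : S.Var),
        QCCS.Dsrb Δ (P.inp c x) (Q.inp c x) ≤ QCCS.Dsrb Δ P Q) ∧
      (∀ (X Y : Finset S.Var) (E : QCCS.SuperOp (QCCS.Idx S X)) (F : QCCS.SuperOp (QCCS.Idx S Y)),
        QCCS.Dsrb Δ (P.op X E) (Q.op Y F) ≤
          max (QCCS.eta X Y) (QCCS.opDist E F + QCCS.Dsrb Δ P Q)) ∧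
      (∀ R : QCCS.Proc S, QCCS.Dsrb Δ (P.sum R) (Q.sum R) ≤ QCCS.Dsrb Δ P Q) ∧
      (∀ (R : QCCS.Proc S) (hP : Disjoint P.fv R.fv) (hQ : Disjoint Q.fv R.fv),
        P.1.AllTP → Q.1.AllTP → R.1.AllTP →
        QCCS.Dsrb Δ (P.par R hP) (Q.par R hQ) ≤ QCCS.Dsrb Δ P Q) ∧
      (∀ L : Set S.Chan, QCCS.Dsrb Δ (P.restr L) (Q.restr L) ≤ QCCS.Dsrb Δ P Q)) := by
  refine ⟨⟨QCCS.dsrb_self, QCCS.dsrb_comm, QCCS.dsrb_triangle⟩, fun P Q => ?_⟩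
  have dP : Disjoint P.fv ∅ := Finset.disjoint_empty_right _
  have dQ : Disjoint Q.fv ∅ := Finset.disjoint_empty_right _
  exact ⟨(QCCS.Context.tau Δ).dsrb_fill_le P Q dP dQ,
    fun c x hP hQ => (QCCS.Context.out Δ c x).dsrb_fill_le P Q
      (Finset.disjoint_singleton_right.2 hP) (Finset.disjoint_singleton_right.2 hQ),
    fun c x => (QCCS.Context.inp Δ c x).dsrb_fill_le P Q dP dQ,
    QCCS.dsrb_op_le P Q,
    fun R => (QCCS.Context.sum Δ R).dsrb_fill_le P Q dP dQ,
    fun R hP hQ _ _ _ => (QCCS.Context.par Δ R).dsrb_fill_le P Q hP hQ,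
    fun L => (QCCS.Context.restr Δ L).dsrb_fill_le P Q dP dQ⟩
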